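/- Let $D\ge 0$, $\varepsilon>0$, and let $p_0,p_1$ be absolutely continuous Borel probability measures on $\mathbb R^D$. For a coupling $\pi$ of $p_0$ and $p_1$ put $$\mathcal C(\pi)=\mathbb E_{\pi}\Big[\tfrac12\|x_0-x_1\|^2\Big]-\varepsilon\int H\big(\pi(\cdot\mid x_0)\big)\,p_0(dx_0),$$ where $H$ is the differential entropy, and let the entropic optimal transport plan $\pi^*$ be a coupling of finite cost that minimizes $\mathcal C$ over all couplings of $p_0$ and $p_1$. For measurable $f\in L^1(p_1)$ and $\xi\in L^1(p_0)$ let $$\mathcal L(f,\xi)=\varepsilon\Big(1-\tfrac D2\log(2\pi\varepsilon)\Big)+\mathbb E_{p_1}[f]-\varepsilon\,\mathbb E_{p_0}[\xi]-\varepsilon\,\mathbb E_{x_0\sim p_0}\mathbb E_{z\sim\mathcal N(0,I)}\exp\Big(\tfrac{f(x_0+\sqrt\varepsilon z)}{\varepsilon}-\xi(x_0)\Big)\in[-\infty,\infty),$$ and let $\mathcal L^*$ be the supremum of $\mathcal L(f,\xi)$ over all such $f,\xi$. Let $$Z(f,x_0)=\int_{\mathbb R^D}e^{(f(x_1)-\frac12\|x_0-x_1\|^2)/\varepsilon}dx_1,\qquad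 \xi_f=\log Z(f,\cdot)-\tfrac D2\log(2\pi\varepsilon),$$ and let $\pi^f$ be the measure on $\mathbb R^D\times\mathbb R^D$ with density $\frac{p_0(x_0)}{Z(f,x_0)}e^{(f(x_1)-\frac12\|x_0-x_1\|^2)/\varepsilon}$. Let $\mathcal F$ be a class of measurable, $p_1$-integrable functions $f$ with $Z(f,x_0)<\infty$ for $p_0$-a.e. $x_0$ (on the exceptional null set $\log Z(f,x_0)$ is read as $0$), and let $\Xi$ be a class of measurable, $p_0$-integrable functions. Let $N,M,K\ge1$, let $x_0^1,\dots,x_0^N\sim p_0$, $x_1^1,\dots,x_1^M\sim p_1$ and $z_{i,k}\sim\mathcal N(0,I)$ ($i\le N$, $k\le K$) be independent, and let $$\widehat{\mathcal L}(f,\xi)=\frac1M\sum_{j=1}^M f(x_1^j)-\frac{\varepsilon}{N}\sum_{i=1}^N\xi(x_0^i)-\frac{\varepsilon}{NK}\sum_{i=1}^N\sum_{k=1}^K\exp\Big(\tfrac{f(x_0^i+\sqrt\varepsilon z_{i,k})}{\varepsilon}-\xi(x_0^i)\Big)+c$$ with an arbitrary additive constant $c\in\mathbb R$ (for instance $c=0$,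 or $c=\varepsilon(1-\frac D2\log(2\pi\varepsilon))$ as in $\mathcal L$). Suppose that one of the following holds. (a) $\xi_f\in\Xi$ for every $f\in\mathcal F$, and almost surely $\hat f\in\arg\max_{f\in\mathcal F}\widehat{\mathcal L}(f,\xi_f)$. (b) Almost surely $(\hat f,\hat\xi)\in\arg\max_{f\in\mathcal F,\ \xi\in\Xi}\widehat{\mathcal L}(f,\xi)$ for some random $\hat\xi$. Then $$\varepsilon\,\mathbb E\big[\mathrm{KL}(\pi^*\,\|\,\pi^{\hat f})\big]\le 2\,\mathbb E\sup_{f\in\mathcal F,\ \xi\in\Xi}\big|\mathcal L(f,\xi)-\widehat{\mathcal L}(f,\xi)\big|+\Big(\mathcal L^*-\sup_{f\in\mathcal F,\ \xi\in\Xi}\mathcal L(f,\xi)\Big),$$ where the expectations are over the random sample and both sides may be $+\infty$. -/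

import Mathlib

open MeasureTheory ProbabilityTheory InformationTheory
open scoped ENNReal

noncomputable section

namespace VarEOT

/-- The state space `ℝ^D` with its Euclidean norm. -/
abbrev E (D : ℕ) : Type := EuclideanSpace ℝ (Fin D)

/-! ### The primal entropic optimal transport problem -/

/-- `π` is a coupling (transport plan) of `p₀` and `p₁`. -/
def IsCoupling {D : ℕ} (p₀ p₁ : Measure (E D)) (π : Measure (E D × E D)) : Prop :=
  π.fst = p₀ ∧ π.snd = p₁

/-- Logarithm of the Lebesgue density of `q`. -/
def logDensity {D : ℕ} (q : Measure (E D)) (x : E D) : ℝ :=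
  Real.log (q.rnDeriv volume x).toReal

/-- Differential entropy `H(q) = -∫ log q(x) q(x) dx` (meaningful for absolutely continuous `q`
with `q`-integrable log-density). -/
def diffEntropy {D : ℕ} (q : Measure (E D)) : ℝ :=
  -∫ x, logDensity q x ∂q

/-- The entropic transport cost of `π` is finite: the quadratic cost is integrable, the conditional
laws `π(· | x₀)` have a density and a finite differential entropy for `p₀`-almost every `x₀`, and
that entropy is `p₀`-integrable. If the quadratic cost of `π` is finite then the remaining
conditions can only fail with a total cost equal to `+∞`, because the entropy of a law with second
moment `m` is bounded above by that of a Gaussian. -/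
structure HasFiniteCost {D : ℕ} (p₀ : Measure (E D)) (π : Measure (E D × E D))
    [IsFiniteMeasure π] : Prop where
  cost : Integrable (fun x : E D × E D => ‖x.1 - x.2‖ ^ 2 / 2) π
  density : ∀ᵐ x₀ ∂p₀, π.condKernel x₀ ≪ volume
  logDensity : ∀ᵐ x₀ ∂p₀,
    Integrable (VarEOT.logDensity (π.condKernel x₀)) (π.condKernel x₀)
  entropy : Integrable (fun x₀ => diffEntropy (π.condKernel x₀)) p₀

/-- The objective `E_π[‖x₀ - x₁‖²/2] - ε ∫ H(π(· | x₀)) p₀(dx₀)`. -/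
def eotCost {D : ℕ} (ε : ℝ) (p₀ : Measure (E D)) (π : Measure (E D × E D))
    [IsFiniteMeasure π] : ℝ :=
  (∫ x : E D × E D, ‖x.1 - x.2‖ ^ 2 / 2 ∂π)
    - ε * ∫ x₀, diffEntropy (π.condKernel x₀) ∂p₀

/-- `π` is an entropic optimal transport plan: a coupling of `p₀` and `p₁` of finite cost that
minimizes the cost over all couplings. -/
def IsEOTPlan {D : ℕ} (ε : ℝ) (p₀ p₁ : Measure (E D)) (π : Measure (E D × E D))
    [IsProbabilityMeasure π] : Prop :=
  IsCoupling p₀ p₁ π ∧ HasFiniteCost p₀ π ∧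
    ∀ (ρ : Measure (E D × E D)) [IsProbabilityMeasure ρ],
      IsCoupling p₀ p₁ ρ → HasFiniteCost p₀ ρ → eotCost ε p₀ π ≤ eotCost ε p₀ ρ

/-! ### Partition function, recovered plans -/

/-- The unnormalized conditional density `exp((f(x₁) - ‖x₀ - x₁‖²/2)/ε)`. -/
def gibbs {D : ℕ} (ε : ℝ) (f : E D → ℝ) (x₀ x₁ : E D) : ℝ :=
  Real.exp ((f x₁ - ‖x₀ - x₁‖ ^ 2 / 2) / ε)

/-- The partition function `Z(f, x₀) = ∫ exp((f(x₁) - ‖x₀ - x₁‖²/2)/ε) dx₁`. -/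
def partitionFn {D : ℕ} (ε : ℝ) (f : E D → ℝ) (x₀ : E D) : ℝ :=
  ∫ x₁, gibbs ε f x₀ x₁

/-- The optimal auxiliary function `ξ_f(x₀) = log Z(f, x₀) - (D/2) log(2πε)`. -/
def optAux {D : ℕ} (ε : ℝ) (f : E D → ℝ) (x₀ : E D) : ℝ :=
  Real.log (partitionFn ε f x₀) - (D : ℝ) / 2 * Real.log (2 * Real.pi * ε)

/-- The measure `π^{f,ξ}` with density `(2πε)^{-D/2} p₀(x₀) exp(-ξ(x₀)) exp((f(x₁) - ‖x₀-x₁‖²/2)/ε)`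
with respect to Lebesgue measure, written relative to `p₀ ⊗ dx₁`. -/
def planAux {D : ℕ} (ε : ℝ) (p₀ : Measure (E D)) (f ξ : E D → ℝ) : Measure (E D × E D) :=
  (p₀.prod volume).withDensity fun x =>
    ENNReal.ofReal ((2 * Real.pi * ε) ^ (-((D : ℝ) / 2)) / Real.exp (ξ x.1) * gibbs ε f x.1 x.2)

/-- The recovered plan `π^f = π^{f, ξ_f}`. -/
def plan {D : ℕ} (ε : ℝ) (p₀ : Measure (E D)) (f : E D → ℝ) : Measure (E D × E D) :=
  planAux ε p₀ f (optAux ε f)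

/-! ### The variational dual objective and its empirical version -/

/-- The additive constant `ε (1 - (D/2) log(2πε))` of the dual objective. -/
def dualConst (D : ℕ) (ε : ℝ) : ℝ :=
  ε * (1 - (D : ℝ) / 2 * Real.log (2 * Real.pi * ε))

/-- The variational dual objective `L(f, ξ)`, for `f` integrable against `p₁` and `ξ` integrable
against `p₀`. The exponential term is an integral of a nonnegative function; `L(f, ξ) = -∞` when
that integral diverges. -/
def dualLoss {D : ℕ} (ε : ℝ) (p₀ p₁ : Measure (E D)) (f ξ : E D → ℝ) : EReal :=
  ((dualConst D ε + (∫ x₁, f x₁ ∂p₁) - ε * ∫ x₀, ξ x₀ ∂p₀ : ℝ) : EReal)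
    - (ε : EReal) *
      ((∫⁻ x₀, ∫⁻ z, ENNReal.ofReal (Real.exp (f (x₀ + Real.sqrt ε • z) / ε - ξ x₀))
          ∂(stdGaussian (E D)) ∂p₀ : ℝ≥0∞) : EReal)

/-- The measurable real functions that are integrable against `p`. -/
def integrableFns {D : ℕ} (p : Measure (E D)) : Set (E D → ℝ) :=
  {g | Measurable g ∧ Integrable g p}

/-- The optimal value `L* = sup_{f, ξ} L(f, ξ)` over all integrable functions. -/
def dualValue {D : ℕ} (ε : ℝ) (p₀ p₁ : Measure (E D)) : EReal :=
  ⨆ f ∈ integrableFns p₁, ⨆ ξ ∈ integrableFns p₀, dualLoss ε p₀ p₁ f ξ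

/-- The data entering the empirical loss: `N` source points, `M` target points, and `K` noise
vectors for each source point. -/
abbrev Sample (D N M K : ℕ) : Type :=
  (Fin N → E D) × (Fin M → E D) × (Fin N × Fin K → E D)

/-- The law of the data: all points are independent, the source points have law `p₀`, the target
points have law `p₁`, and the noise vectors are standard Gaussian. -/
def sampleLaw {D : ℕ} (p₀ p₁ : Measure (E D)) (N M K : ℕ) : Measure (Sample D N M K) :=
  (Measure.pi fun _ : Fin N => p₀).prod
    ((Measure.pi fun _ : Fin M => p₁).prod
      (Measure.pi fun _ : Fin N × Fin K => stdGaussian (E D)))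

/-- The empirical loss (without the additive constant). -/
def empLoss {D N M K : ℕ} (ε : ℝ) (s : Sample D N M K) (f ξ : E D → ℝ) : ℝ :=
  1 / (M : ℝ) * (∑ j, f (s.2.1 j)) - ε * (1 / (N : ℝ)) * (∑ i, ξ (s.1 i))
    - ε / ((N : ℝ) * (K : ℝ)) *
      ∑ i, ∑ k, Real.exp (f (s.1 i + Real.sqrt ε • s.2.2 (i, k)) / ε - ξ (s.1 i))

/-- The uniform deviation `sup_{f ∈ F, ξ ∈ Ξ} |L(f, ξ) - (L̂(f, ξ) + c)|`, in `[0, ∞]`. -/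
def deviation {D N M K : ℕ} (ε : ℝ) (p₀ p₁ : Measure (E D)) (F Ξ : Set (E D → ℝ)) (c : ℝ)
    (s : Sample D N M K) : ℝ≥0∞ :=
  ⨆ f ∈ F, ⨆ ξ ∈ Ξ, (dualLoss ε p₀ p₁ f ξ - ((empLoss ε s f ξ + c : ℝ) : EReal)).abs

end VarEOT

end

noncomputable section

/-! Let R be the law of (x₀, x₀ + √ε z) and κ = (D/2) log(2πε). A coupling with R-density e has cost
ε ∫ log e dπ − εκ, because the quadratic cost cancels the exponent of the Gaussian kernel. With h =
f(x₁)/ε − ξ(x₀), the dual objective is L(f, ξ) = ε(∫ h dπ − ∫ e^h dR + 1) − εκ, for any coupling π.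
Primal and dual are thus an entropy minimization with prescribed marginals and its convex dual.

The plan π^f has R-density exp(f/ε − ξ_f). Expanding the logarithm gives ε KL(π*‖π^f) = C(π*) − L(f,
ξ_f), and 1 + x ≤ e^x gives L(f, ξ) ≤ L(f, ξ_f); hence ε KL(π*‖π^f) ≤ C(π*) − L(f, ξ)
(`IsEOTPlan.klDiv_plan_le`).

Strong duality C(π*) ≤ L* (`IsEOTPlan.eotCost_le_dualValue`) comes from a general fact
(`exists_sq_density_of_entDual_le`): a bounded dual supremum S produces a density with the right
marginals and entropy at most S. Along a maximizing sequence, the functions e^{h/2} are Cauchy in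
L²(R); their limit, squared, is the density.

If δ is the uniform deviation, empirical optimality gives sup L ≤ L(f̂, ξ̂) + 2δ. So ε KL ≤ C(π*) −
L(f̂, ξ̂) ≤ 2δ + (L* − sup L) sample by sample, and this is integrated. -/

namespace VarEOT

/-! ### The Gaussian kernel and the reference plan. -/

/-- The density of `N(x₀, ε I)` at `x₁`. -/
def heatDensity {D : ℕ} (ε : ℝ) (x₀ x₁ : E D) : ℝ :=
  (2 * Real.pi * ε) ^ (-((D : ℝ) / 2)) * Real.exp (-(‖x₀ - x₁‖ ^ 2 / (2 * ε)))

lemma heatDensity_pos {D : ℕ} {ε : ℝ} (hε : 0 < ε) (x₀ x₁ : E D) : 0 < heatDensity ε x₀ x₁ := by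
  unfold heatDensity; positivity

lemma measurable_heatDensity {D : ℕ} (ε : ℝ) :
    Measurable fun x : E D × E D => heatDensity ε x.1 x.2 := by
  unfold heatDensity; fun_prop

lemma measurable_heatDensity_right {D : ℕ} (ε : ℝ) (x₀ : E D) :
    Measurable (heatDensity ε x₀) := by
  unfold heatDensity; fun_prop

lemma integral_heatDensity_zero {D : ℕ} {ε : ℝ} (hε : 0 < ε) :
    Integrable (heatDensity ε (0 : E D)) ∧ ∫ x, heatDensity ε (0 : E D) x = 1 := by
  have hb : 0 < 1 / (2 * ε) := by positivity
  have h0 : heatDensity ε (0 : E D) = fun x => (2 * Real.pi * ε) ^ (-((D : ℝ) / 2)) *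
      Real.exp (-(1 / (2 * ε)) * ‖x‖ ^ 2) := by
    ext x; simp only [heatDensity, zero_sub, norm_neg]; congr 2; ring
  have h1 := GaussianFourier.integral_rexp_neg_mul_sq_norm (V := E D) hb
  have h2 : Real.pi / (1 / (2 * ε)) = 2 * Real.pi * ε := by field_simp
  rw [h2, finrank_euclideanSpace_fin] at h1
  have hpos : 0 < (2 * Real.pi * ε) ^ ((D : ℝ) / 2) := by positivity
  constructor
  · rw [h0]
    refine Integrable.const_mul ?_ _
    -- A non-integrable function has integral 0 by convention, so the positive value in `h1` forces
    -- integrability.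
    by_contra h
    rw [integral_undef h] at h1
    exact hpos.ne h1
  · rw [h0, integral_const_mul, h1, ← Real.rpow_add (by positivity)]
    simp

lemma lintegral_heatDensity_zero {D : ℕ} {ε : ℝ} (hε : 0 < ε) :
    ∫⁻ x, ENNReal.ofReal (heatDensity ε (0 : E D) x) = 1 := by
  rw [← ofReal_integral_eq_lintegral_ofReal (integral_heatDensity_zero hε).1
    (.of_forall fun x => (heatDensity_pos hε 0 x).le), (integral_heatDensity_zero hε).2]
  simp

/-- Two probability measures with the same characteristic function coincide, and the Fourier
transform of a Gaussian density is explicit. -/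
lemma map_sqrt_smul_stdGaussian {D : ℕ} {ε : ℝ} (hε : 0 < ε) :
    (stdGaussian (E D)).map (fun z => Real.sqrt ε • z)
      = volume.withDensity fun x => ENNReal.ofReal (heatDensity ε 0 x) := by
  have : IsProbabilityMeasure ((volume : Measure (E D)).withDensity
      fun x => ENNReal.ofReal (heatDensity ε 0 x)) :=
    ⟨by rw [withDensity_apply _ .univ, setLIntegral_univ, lintegral_heatDensity_zero hε]⟩
  have : IsProbabilityMeasure ((stdGaussian (E D)).map (fun z => Real.sqrt ε • z)) :=
    Measure.isProbabilityMeasure_map (by fun_prop)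
  have hm : Measurable (heatDensity ε (0 : E D)) := measurable_heatDensity_right ε 0
  apply Measure.ext_of_charFun
  ext t
  rw [charFun_map_smul, charFun_stdGaussian, charFun_apply,
    integral_withDensity_eq_integral_toReal_smul hm.ennreal_ofReal (by simp)]
  have hb : 0 < ((1 / (2 * ε) : ℝ) : ℂ).re := by simpa using hε
  have key := GaussianFourier.integral_cexp_neg_mul_sq_norm_add (V := E D) hb Complex.I t
  have e1 : ∀ x : E D, (ENNReal.ofReal (heatDensity ε 0 x)).toReal •
      Complex.exp (inner ℝ x t * Complex.I) =
      (((2 * Real.pi * ε) ^ (-((D : ℝ) / 2)) : ℝ) : ℂ) *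
        Complex.exp (-((1 / (2 * ε) : ℝ) : ℂ) * ‖x‖ ^ 2 + Complex.I * inner ℝ t x) := by
    intro x
    rw [ENNReal.toReal_ofReal (heatDensity_pos hε 0 x).le, Complex.exp_add, Complex.real_smul,
      heatDensity, zero_sub, norm_neg, real_inner_comm]
    push_cast
    rw [mul_assoc]
    congr 3
    · ring
    · ring
  simp_rw [e1]
  rw [integral_const_mul, key, finrank_euclideanSpace_fin]
  have h2 : ((Real.pi : ℂ) / ((1 / (2 * ε) : ℝ) : ℂ)) = ((2 * Real.pi * ε : ℝ) : ℂ) := by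
    have : (ε : ℂ) ≠ 0 := by exact_mod_cast hε.ne'
    push_cast; field_simp
  have h3 : ((D : ℂ) / 2) = (((D : ℝ) / 2 : ℝ) : ℂ) := by push_cast; rfl
  rw [h2, h3, ← Complex.ofReal_cpow (by positivity), ← mul_assoc, ← Complex.ofReal_mul,
    ← Real.rpow_add (by positivity)]
  simp only [neg_add_cancel, Real.rpow_zero, Complex.ofReal_one, one_mul, norm_smul,
    Real.norm_eq_abs, abs_of_nonneg (Real.sqrt_nonneg ε)]
  have : (ε : ℂ) ≠ 0 := by exact_mod_cast hε.ne'
  have hsq : ((Real.sqrt ε * ‖t‖ : ℝ) : ℂ) ^ 2 = ε * ‖t‖ ^ 2 := by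
    rw [← Complex.ofReal_pow, mul_pow, Real.sq_sqrt hε.le]; push_cast; rfl
  rw [hsq]
  push_cast
  congr 1
  simp only [Complex.I_sq]
  field_simp
  norm_num

lemma heatDensity_add_right {D : ℕ} (ε : ℝ) (x₀ y : E D) :
    heatDensity ε x₀ (x₀ + y) = heatDensity ε 0 y := by
  simp [heatDensity]

lemma lintegral_stdGaussian_add {D : ℕ} {ε : ℝ} (hε : 0 < ε) {F : E D → ℝ≥0∞}
    (hF : Measurable F) (x₀ : E D) :
    ∫⁻ z, F (x₀ + Real.sqrt ε • z) ∂(stdGaussian (E D))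
      = ∫⁻ x₁, ENNReal.ofReal (heatDensity ε x₀ x₁) * F x₁ := by
  have hm : Measurable (heatDensity ε (0 : E D)) := measurable_heatDensity_right ε 0
  have hG : Measurable fun y => F (x₀ + y) := by fun_prop
  rw [← lintegral_map (f := fun y => F (x₀ + y)) (g := fun z => Real.sqrt ε • z) hG (by fun_prop),
    map_sqrt_smul_stdGaussian hε, lintegral_withDensity_eq_lintegral_mul _ hm.ennreal_ofReal hG,
    ← lintegral_add_left_eq_self (fun x₁ => ENNReal.ofReal (heatDensity ε x₀ x₁) * F x₁) x₀]
  simp [heatDensity_add_right]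

lemma lintegral_heatDensity {D : ℕ} {ε : ℝ} (hε : 0 < ε) (x₀ : E D) :
    ∫⁻ x₁, ENNReal.ofReal (heatDensity ε x₀ x₁) = 1 := by
  rw [← lintegral_add_left_eq_self _ x₀]
  simp_rw [heatDensity_add_right]
  exact lintegral_heatDensity_zero hε

/-- The law of `(x₀, x₀ + √ε z)` with `x₀ ∼ p₀` and `z` standard Gaussian. -/
def refPlan {D : ℕ} (ε : ℝ) (p₀ : Measure (E D)) : Measure (E D × E D) :=
  (p₀.prod volume).withDensity fun x => ENNReal.ofReal (heatDensity ε x.1 x.2)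

lemma lintegral_refPlan {D : ℕ} (ε : ℝ) (p₀ : Measure (E D)) [SFinite p₀]
    {F : E D × E D → ℝ≥0∞} (hF : Measurable F) :
    ∫⁻ x, F x ∂(refPlan ε p₀)
      = ∫⁻ x₀, ∫⁻ x₁, ENNReal.ofReal (heatDensity ε x₀ x₁) * F (x₀, x₁) ∂volume ∂p₀ := by
  have hm := (measurable_heatDensity (D := D) ε).ennreal_ofReal
  rw [refPlan, lintegral_withDensity_eq_lintegral_mul _ hm hF, lintegral_prod _ (by fun_prop)]
  rfl

instance refPlan_isProb {D : ℕ} (ε : ℝ) [hε : Fact (0 < ε)] (p₀ : Measure (E D))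
    [IsProbabilityMeasure p₀] : IsProbabilityMeasure (refPlan ε p₀) :=
  ⟨by
    have := lintegral_refPlan ε p₀ (F := fun _ => 1) measurable_const
    simpa [lintegral_heatDensity hε.out] using this⟩

/-- Half of the exponent is cancelled, which doubles the variance; the factor 2^(D/2) is the ratio
of normalizations. -/
lemma exp_mul_heatDensity {D : ℕ} {ε : ℝ} (hε : 0 < ε) (x₀ x₁ : E D) :
    heatDensity ε x₀ x₁ * Real.exp (‖x₀ - x₁‖ ^ 2 / (4 * ε))
      = 2 ^ ((D : ℝ) / 2) * heatDensity (2 * ε) x₀ x₁ := by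
  unfold heatDensity
  rw [mul_assoc, ← Real.exp_add, ← mul_assoc]
  congr 1
  · rw [show 2 * Real.pi * (2 * ε) = 2 * (2 * Real.pi * ε) by ring,
      Real.mul_rpow (x := 2) (y := 2 * Real.pi * ε) (by norm_num) (by positivity), ← mul_assoc,
      ← Real.rpow_add (by norm_num : (0 : ℝ) < 2)]
    simp
  · congr 1; field_simp; ring

/-- This exponential moment is what lets finite entropy relative to the reference plan control the
quadratic cost. -/
lemma lintegral_exp_refPlan_lt_top {D : ℕ} {ε : ℝ} (hε : 0 < ε) (p₀ : Measure (E D))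
    [IsProbabilityMeasure p₀] :
    ∫⁻ x, ENNReal.ofReal (Real.exp (‖x.1 - x.2‖ ^ 2 / (4 * ε))) ∂(refPlan ε p₀) < ∞ := by
  rw [lintegral_refPlan ε p₀ (by fun_prop)]
  simp_rw [← ENNReal.ofReal_mul (heatDensity_pos hε _ _).le, exp_mul_heatDensity hε]
  have h2 : (0 : ℝ) ≤ 2 ^ ((D : ℝ) / 2) := by positivity
  have : ∀ x₀ : E D, ∫⁻ x₁, ENNReal.ofReal (2 ^ ((D : ℝ) / 2) * heatDensity (2 * ε) x₀ x₁)
      = ENNReal.ofReal (2 ^ ((D : ℝ) / 2)) := by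
    intro x₀
    simp_rw [ENNReal.ofReal_mul h2]
    rw [lintegral_const_mul' _ _ (by simp), lintegral_heatDensity (by positivity), mul_one]
  simp [this]

/-! ### Convex duality for entropy minimization under linear constraints. -/

section EntropyDuality

open Filter Topology

variable {Ω : Type*} [MeasurableSpace Ω]

/-- The bounded measurable real functions. -/
def boundedFns (Ω : Type*) [MeasurableSpace Ω] : Submodule ℝ (Ω → ℝ) where
  carrier := {h | Measurable h ∧ ∃ C, ∀ x, |h x| ≤ C}
  zero_mem' := ⟨measurable_const, 0, by simp⟩
  add_mem' := by
    rintro f g ⟨hf, C, hC⟩ ⟨hg, C', hC'⟩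
    exact ⟨hf.add hg, C + C', fun x => (abs_add_le _ _).trans (add_le_add (hC x) (hC' x))⟩
  smul_mem' := by
    rintro c f ⟨hf, C, hC⟩
    refine ⟨hf.const_smul c, |c| * C, fun x => ?_⟩
    simpa [abs_mul] using mul_le_mul_of_nonneg_left (hC x) (abs_nonneg c)

lemma integrable_of_mem_boundedFns {ν : Measure Ω} [IsFiniteMeasure ν] {h : Ω → ℝ}
    (hh : h ∈ boundedFns Ω) : Integrable h ν := by
  obtain ⟨hm, C, hC⟩ := hh
  exact .of_bound hm.aestronglyMeasurable C (.of_forall hC)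

lemma exp_mem_boundedFns {h : Ω → ℝ} (hh : h ∈ boundedFns Ω) :
    (fun x => Real.exp (h x)) ∈ boundedFns Ω := by
  obtain ⟨hm, C, hC⟩ := hh
  refine ⟨hm.exp, Real.exp C, fun x => ?_⟩
  rw [abs_of_pos (Real.exp_pos _)]
  exact Real.exp_le_exp.2 ((le_abs_self _).trans (hC x))

lemma mul_mem_boundedFns {f g : Ω → ℝ} (hf : f ∈ boundedFns Ω) (hg : g ∈ boundedFns Ω) :
    (fun x => f x * g x) ∈ boundedFns Ω := by
  obtain ⟨hm, C, hC⟩ := hf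
  obtain ⟨hm', C', hC'⟩ := hg
  refine ⟨hm.mul hm', C * C', fun x => ?_⟩
  rw [abs_mul]
  exact mul_le_mul (hC x) (hC' x) (abs_nonneg _) ((abs_nonneg _).trans (hC x))

lemma integrableExpSet_of_mem_boundedFns {ν : Measure Ω} [IsFiniteMeasure ν] {h : Ω → ℝ}
    (hh : h ∈ boundedFns Ω) : integrableExpSet h ν = Set.univ := by
  ext t
  simp only [integrableExpSet, Set.mem_ofPred_eq, Set.mem_univ, iff_true]
  exact integrable_of_mem_boundedFns
    (exp_mem_boundedFns ((boundedFns Ω).smul_mem t hh))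

lemma hasDerivAt_mgf_of_mem_boundedFns {ν : Measure Ω} [IsFiniteMeasure ν] {h : Ω → ℝ}
    (hh : h ∈ boundedFns Ω) (t : ℝ) :
    HasDerivAt (mgf h ν) (∫ x, h x * Real.exp (t * h x) ∂ν) t :=
  hasDerivAt_mgf (by simp [integrableExpSet_of_mem_boundedFns hh])

/-- The dual objective `∫ h dμ - ∫ (e^h - 1) dR` of an entropy minimization problem relative to
a probability measure `ν`. -/
def entDual (ν μ : Measure Ω) (h : Ω → ℝ) : ℝ :=
  ∫ x, h x ∂μ - ∫ x, Real.exp (h x) ∂ν + 1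

/-- Optimizing the dual objective along a ray. -/
lemma exists_smul_entDual_ge (ν μ : Measure Ω) [IsFiniteMeasure ν] {h : Ω → ℝ}
    (hh : h ∈ boundedFns Ω) :
    ∃ t : ℝ, entDual ν μ h ≤ entDual ν μ (t • h) ∧
      ∫ x, (t • h) x * Real.exp ((t • h) x) ∂ν ≤ ∫ x, (t • h) x ∂μ := by
  have hJ : ∀ t : ℝ, entDual ν μ (t • h) = t * ∫ x, h x ∂μ - mgf h ν t + 1 := by
    intro t; simp [entDual, mgf, integral_const_mul]
  have hd : ∀ t : ℝ, HasDerivAt (fun t => t * ∫ x, h x ∂μ - mgf h ν t + 1)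
      (∫ x, h x ∂μ - ∫ x, h x * Real.exp (t * h x) ∂ν) t := by
    intro t
    simpa using (((hasDerivAt_id t).mul_const (∫ x, h x ∂μ)).sub
      (hasDerivAt_mgf_of_mem_boundedFns hh t)).add_const 1
  -- The segment [0, 1] is compact and contains t = 1, which gives the first claim. At a maximizer t
  -- > 0 the derivative is nonnegative, since points to its left are no better; multiplied by t,
  -- this is the second claim.
  obtain ⟨t, ht, hmax⟩ := isCompact_Icc.exists_isMaxOn (Set.nonempty_Icc.2 zero_le_one)
    (HasDerivAt.continuousOn (s := Set.Icc (0 : ℝ) 1) fun t _ => hd t)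
  refine ⟨t, ?_, ?_⟩
  · have := hmax (Set.right_mem_Icc.2 zero_le_one)
    simp only [Set.mem_ofPred_eq, ← hJ, one_smul] at this
    exact this
  · rcases ht.1.eq_or_lt with rfl | h0
    · simp
    · have hnn : 0 ≤ ∫ x, h x ∂μ - ∫ x, h x * Real.exp (t * h x) ∂ν := by
        by_contra! hneg
        have := (hd t).hasDerivWithinAt (s := Set.Iio t)
        rw [hasDerivWithinAt_iff_tendsto_slope' (by simp)] at this
        have hev := this.eventually (gt_mem_nhds hneg)
        have hev2 : ∀ᶠ s in 𝓝[<] t, s ∈ Set.Ioo 0 t := Ioo_mem_nhdsLT h0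
        obtain ⟨s, hs1, hs2⟩ := (hev.and hev2).exists
        have hs3 := hmax (show s ∈ Set.Icc (0 : ℝ) 1 from ⟨hs2.1.le, hs2.2.le.trans ht.2⟩)
        simp only [Set.mem_ofPred_eq] at hs3
        rw [slope_def_field, div_lt_iff_of_neg (by linarith [hs2.2])] at hs1
        linarith
      have : ∫ x, (t • h) x * Real.exp ((t • h) x) ∂ν
          = t * ∫ x, h x * Real.exp (t * h x) ∂ν := by
        simp [← integral_const_mul, mul_assoc]
      rw [this]
      simp only [Pi.smul_apply, smul_eq_mul, integral_const_mul]
      nlinarith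

/-- Midpoint identity for the dual objective. -/
lemma entDual_midpoint (ν μ : Measure Ω) [IsFiniteMeasure ν] [IsFiniteMeasure μ] {h k : Ω → ℝ}
    (hh : h ∈ boundedFns Ω) (hk : k ∈ boundedFns Ω) :
    ∫ x, (Real.exp (h x / 2) - Real.exp (k x / 2)) ^ 2 ∂ν
      = 2 * entDual ν μ ((2⁻¹ : ℝ) • (h + k)) - entDual ν μ h - entDual ν μ k := by
  -- The cross term of the square is the exponential at the midpoint, and the linear parts cancel:
  -- strict concavity is measured by the squared L² distance of the square roots of the densities.
  have e1 : ∀ x, (Real.exp (h x / 2) - Real.exp (k x / 2)) ^ 2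
      = Real.exp (h x) + Real.exp (k x) - 2 * Real.exp (2⁻¹ * (h x + k x)) := by
    intro x
    have a1 : Real.exp (h x) = Real.exp (h x / 2) * Real.exp (h x / 2) := by
      rw [← Real.exp_add]; ring_nf
    have a2 : Real.exp (k x) = Real.exp (k x / 2) * Real.exp (k x / 2) := by
      rw [← Real.exp_add]; ring_nf
    have a3 : Real.exp (2⁻¹ * (h x + k x)) = Real.exp (h x / 2) * Real.exp (k x / 2) := by
      rw [← Real.exp_add]; ring_nf
    rw [a1, a2, a3]; ring
  have i1 := integrable_of_mem_boundedFns (ν := ν) (exp_mem_boundedFns hh)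
  have i2 := integrable_of_mem_boundedFns (ν := ν) (exp_mem_boundedFns hk)
  have i3 := integrable_of_mem_boundedFns (ν := ν) (exp_mem_boundedFns
    ((boundedFns Ω).smul_mem 2⁻¹ ((boundedFns Ω).add_mem hh hk)))
  simp only [Pi.smul_apply, Pi.add_apply, smul_eq_mul] at i3
  simp_rw [e1]
  have hsub := integral_sub (i1.add i2) (i3.const_mul 2)
  simp only [Pi.add_apply] at hsub
  rw [hsub, integral_add i1 i2, integral_const_mul]
  simp only [entDual, Pi.smul_apply, Pi.add_apply, smul_eq_mul, integral_const_mul]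
  rw [integral_add (integrable_of_mem_boundedFns hh) (integrable_of_mem_boundedFns hk)]
  ring

lemma norm_toLp_two_sq {ν : Measure Ω} {f : Ω → ℝ} (hf : MemLp f 2 ν) :
    ‖hf.toLp f‖ ^ 2 = ∫ x, f x ^ 2 ∂ν := by
  rw [← real_inner_self_eq_norm_sq, L2.inner_def]
  refine integral_congr_ae ?_
  filter_upwards [hf.coeFn_toLp] with x hx
  simp [hx, sq]

/-- Bounded weights are compatible with the convergence of squares in `L²`. -/
lemma tendsto_integral_mul_sq {ν : Measure Ω} [IsFiniteMeasure ν] {u : ℕ → Ω → ℝ}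
    (hu : ∀ n, MemLp (u n) 2 ν) {G : Lp ℝ 2 ν} (hG : Tendsto (fun n => (hu n).toLp (u n)) atTop (𝓝 G))
    {w : Ω → ℝ} (hw : w ∈ boundedFns Ω) :
    Tendsto (fun n => ∫ x, w x * u n x ^ 2 ∂ν) atTop (𝓝 (∫ x, w x * G x ^ 2 ∂ν)) := by
  obtain ⟨hwm, C, hC⟩ := hw
  have hmul : ∀ {f : Ω → ℝ}, MemLp f 2 ν → MemLp (fun x => w x * f x) 2 ν := fun hf =>
    hf.of_le_mul (c := C) (hwm.aestronglyMeasurable.mul hf.1) (.of_forall fun x => by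
      rw [norm_mul]; exact mul_le_mul_of_nonneg_right (hC x) (norm_nonneg _))
  have hGm := hmul (Lp.memLp G)
  have h1 : Tendsto (fun n => (hmul (hu n)).toLp _) atTop (𝓝 (hGm.toLp _)) := by
    rw [tendsto_iff_dist_tendsto_zero] at hG ⊢
    refine squeeze_zero (fun _ => dist_nonneg) (fun n => ?_) (by simpa using hG.const_mul C)
    rw [dist_eq_norm, dist_eq_norm]
    refine Lp.norm_le_mul_norm_of_ae_le_mul ?_
    filter_upwards [(hmul (hu n)).coeFn_toLp, hGm.coeFn_toLp, (hu n).coeFn_toLp,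
      Lp.coeFn_sub ((hmul (hu n)).toLp _) (hGm.toLp _),
      Lp.coeFn_sub ((hu n).toLp _) G] with x h1 h2 h3 h4 h5
    rw [h4, h5, Pi.sub_apply, Pi.sub_apply, h1, h2, h3, ← mul_sub, norm_mul]
    exact mul_le_mul_of_nonneg_right (hC x) (norm_nonneg _)
  have h2 := h1.inner (𝕜 := ℝ) hG
  simp only [L2.inner_def] at h2
  refine (h2.congr fun n => ?_).trans_eq ?_
  · refine integral_congr_ae ?_
    filter_upwards [(hmul (hu n)).coeFn_toLp, (hu n).coeFn_toLp] with x h1 h2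
    simp [h1, h2, sq]; ring
  · congr 1
    refine integral_congr_ae ?_
    filter_upwards [hGm.coeFn_toLp] with x h1
    simp [h1, sq]; ring

/-- If the dual objective is bounded above by `S` on a space `V` of bounded functions, then some
`ν`-density `g²` has the same integrals as `μ` on `V` and relative entropy at most `S`. -/
theorem exists_sq_density_of_entDual_le (ν μ : Measure Ω) [IsProbabilityMeasure ν]
    [IsProbabilityMeasure μ] (V : Submodule ℝ (Ω → ℝ)) (hV : V ≤ boundedFns Ω) {S : ℝ}
    (hS : ∀ h ∈ V, entDual ν μ h ≤ S) :
    ∃ g : Ω → ℝ, Measurable g ∧ MemLp g 2 ν ∧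
      (∀ h ∈ V, ∫ x, h x * g x ^ 2 ∂ν = ∫ x, h x ∂μ) ∧
      ∫⁻ x, ENNReal.ofReal (klFun (g x ^ 2)) ∂ν ≤ ENNReal.ofReal S := by
  -- The Cauchy estimate needs the exact supremum, not just the bound `S`.
  set s : ℝ := ⨆ h : V, entDual ν μ h with hs
  have hbdd : BddAbove (Set.range fun h : V => entDual ν μ h) :=
    ⟨S, by rintro _ ⟨h, rfl⟩; exact hS h h.2⟩
  have hle : ∀ h ∈ V, entDual ν μ h ≤ s := fun h hh => le_ciSup hbdd ⟨h, hh⟩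
  have hex : ∀ n : ℕ, ∃ h ∈ V, s - 1 / ((n : ℝ) + 1) ≤ entDual ν μ h ∧
      ∫ x, h x * Real.exp (h x) ∂ν ≤ ∫ x, h x ∂μ := by
    intro n
    obtain ⟨⟨h, hh⟩, hlt⟩ := exists_lt_of_lt_ciSup
      (show s - 1 / ((n : ℝ) + 1) < ⨆ h : V, entDual ν μ h by
        rw [← hs]; have : 0 < 1 / ((n : ℝ) + 1) := by positivity
        linarith)
    obtain ⟨t, ht, ht'⟩ := exists_smul_entDual_ge ν μ (hV hh)
    exact ⟨t • h, V.smul_mem t hh, hlt.le.trans ht, ht'⟩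
  choose h hhV hJ hray using hex
  set u : ℕ → Ω → ℝ := fun n x => Real.exp (h n x / 2) with hudef
  have husq : ∀ n x, u n x ^ 2 = Real.exp (h n x) := by
    intro n x; rw [hudef, sq, ← Real.exp_add]; ring_nf
  have hub : ∀ n, u n ∈ boundedFns Ω := by
    intro n
    have := exp_mem_boundedFns ((boundedFns Ω).smul_mem (2⁻¹ : ℝ) (hV (hhV n)))
    convert this using 2 with x
    simp [hudef, div_eq_inv_mul]
  have hu : ∀ n, MemLp (u n) 2 ν := fun n => by
    obtain ⟨hm, C, hC⟩ := hub n
    exact .of_bound hm.aestronglyMeasurable C (.of_forall hC)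
  -- The midpoint stays in `V`, so its value is at most `s`, while both endpoints are within 1/(n+1)
  -- and 1/(m+1) of `s`.
  have hdist : ∀ n m, ‖(hu n).toLp _ - (hu m).toLp _‖ ^ 2
      ≤ 1 / ((n : ℝ) + 1) + 1 / ((m : ℝ) + 1) := by
    intro n m
    rw [← MemLp.toLp_sub, norm_toLp_two_sq]
    simp only [Pi.sub_apply, hudef]
    rw [entDual_midpoint ν μ (hV (hhV n)) (hV (hhV m))]
    have := hle _ (V.smul_mem (2⁻¹ : ℝ) (V.add_mem (hhV n) (hhV m)))
    linarith [hJ n, hJ m]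
  have hcau : CauchySeq fun n => (hu n).toLp (u n) := by
    refine cauchySeq_of_le_tendsto_0 (fun N : ℕ => Real.sqrt (2 * (1 / ((N : ℝ) + 1))))
      (fun n m N hn hm => ?_) ?_
    · rw [dist_eq_norm]
      refine Real.le_sqrt_of_sq_le ((hdist n m).trans ?_)
      have h1 : 1 / ((n : ℝ) + 1) ≤ 1 / ((N : ℝ) + 1) := by gcongr
      have h2 : 1 / ((m : ℝ) + 1) ≤ 1 / ((N : ℝ) + 1) := by gcongr
      linarith
    · have := (tendsto_one_div_add_atTop_nhds_zero_nat (𝕜 := ℝ)).const_mul 2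
      have hlim := (Real.continuous_sqrt.tendsto _).comp this
      rw [mul_zero, Real.sqrt_zero] at hlim
      exact hlim
  obtain ⟨G, hG⟩ := cauchySeq_tendsto_of_complete hcau
  have hGm : Measurable G := (Lp.stronglyMeasurable G).measurable
  refine ⟨G, hGm, Lp.memLp G, ?_, ?_⟩
  · intro w hw
    set π : Measure Ω := ν.withDensity fun x => ENNReal.ofReal (G x ^ 2) with hπ
    have hπint : ∀ φ : Ω → ℝ, ∫ x, φ x ∂π = ∫ x, φ x * G x ^ 2 ∂ν := by
      intro φ
      rw [hπ, integral_withDensity_eq_integral_toReal_smul (by fun_prop) (by simp)]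
      refine integral_congr_ae (.of_forall fun x => ?_)
      simp [ENNReal.toReal_ofReal (sq_nonneg (G x)), mul_comm]
    have : IsFiniteMeasure π := isFiniteMeasure_withDensity_ofReal
      ((Lp.memLp G).integrable_sq.2)
    -- Moving from h_n to h_n + t w gains at most 1/(n+1). The gain is t ∫ w dμ − ∫ (e^{tw} − 1)
    -- u_n² dν, and n → ∞ removes the error.
    have hstat : ∀ t : ℝ, t * ∫ x, w x ∂μ ≤ ∫ x, (Real.exp (t * w x) - 1) * G x ^ 2 ∂ν := by
      intro t
      have hwb : (fun x => Real.exp (t * w x)) ∈ boundedFns Ω :=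
        exp_mem_boundedFns (hV (V.smul_mem t hw))
      have hwb' : (fun x => Real.exp (t * w x) - 1) ∈ boundedFns Ω := by
        refine (boundedFns Ω).sub_mem hwb (?_ : (fun _ => (1 : ℝ)) ∈ boundedFns Ω)
        exact ⟨measurable_const, 1, by simp⟩
      have hlim := (tendsto_integral_mul_sq hu hG hwb').add
        (tendsto_one_div_add_atTop_nhds_zero_nat (𝕜 := ℝ))
      rw [add_zero] at hlim
      refine ge_of_tendsto' hlim fun n => ?_
      have h1 := hle _ (V.add_mem (hhV n) (V.smul_mem t hw))
      have h2 := hJ n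
      have i1 := integrable_of_mem_boundedFns (ν := ν) (exp_mem_boundedFns (hV (hhV n)))
      have i2 := integrable_of_mem_boundedFns (ν := ν) (mul_mem_boundedFns hwb
        (exp_mem_boundedFns (hV (hhV n))))
      have e1 : ∫ x, (Real.exp (t * w x) - 1) * u n x ^ 2 ∂ν
          = ∫ x, Real.exp (t * w x) * Real.exp (h n x) ∂ν - ∫ x, Real.exp (h n x) ∂ν := by
        rw [← integral_sub i2 i1]
        refine integral_congr_ae (.of_forall fun x => ?_)
        simp only [husq]; ring
      have e2 : entDual ν μ (h n + t • w) = ∫ x, h n x ∂μ + t * ∫ x, w x ∂μ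
          - ∫ x, Real.exp (t * w x) * Real.exp (h n x) ∂ν + 1 := by
        simp only [entDual, Pi.add_apply, Pi.smul_apply, smul_eq_mul]
        rw [integral_add (integrable_of_mem_boundedFns (hV (hhV n)))
          ((integrable_of_mem_boundedFns (hV hw)).const_mul t), integral_const_mul]
        simp_rw [Real.exp_add, mul_comm (Real.exp (h n _))]
      rw [e2] at h1
      rw [e1]
      simp only [entDual] at h2
      linarith
    -- By `hstat` this function of t is smallest at t = 0; its derivative there is the difference of
    -- the two integrals of w.
    have hmin : IsLocalMin (fun t => mgf w π t - t * ∫ x, w x ∂μ) 0 := by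
      refine .of_forall fun t => ?_
      have i1 : Integrable (fun x => Real.exp (t * w x)) π :=
        integrable_of_mem_boundedFns (exp_mem_boundedFns (hV (V.smul_mem t hw)))
      have := hstat t
      rw [← hπint, integral_sub i1 (integrable_const 1)] at this
      simp only [mgf, zero_mul, Real.exp_zero, sub_zero]
      linarith
    have hder := (hasDerivAt_mgf_of_mem_boundedFns (ν := π) (hV hw) 0).sub
      ((hasDerivAt_id (0 : ℝ)).mul_const (∫ x, w x ∂μ))
    have := hmin.hasDerivAt_eq_zero hder
    rw [← hπint]
    simp only [zero_mul, Real.exp_zero, mul_one, one_mul] at this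
    linarith
  · obtain ⟨ns, -, hns⟩ := (tendstoInMeasure_of_tendsto_Lp hG).exists_seq_tendsto_ae
    have hae : ∀ᵐ x ∂ν, ∀ n, (hu n).toLp (u n) x = u n x :=
      ae_all_iff.2 fun n => (hu n).coeFn_toLp
    -- Since klFun(e^h) = h e^h + 1 − e^h, the ray inequality bounds the entropy by the dual value.
    -- Fatou along an a.e. convergent subsequence then passes the bound to the limit.
    have hbound : ∀ n, ∫⁻ x, ENNReal.ofReal (klFun (u n x ^ 2)) ∂ν ≤ ENNReal.ofReal S := by
      intro n
      have i1 := integrable_of_mem_boundedFns (ν := ν) (exp_mem_boundedFns (hV (hhV n)))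
      have i2 := integrable_of_mem_boundedFns (ν := ν) (mul_mem_boundedFns (hV (hhV n))
        (exp_mem_boundedFns (hV (hhV n))))
      have e1 : ∀ x, klFun (u n x ^ 2) = h n x * Real.exp (h n x) + 1 - Real.exp (h n x) := by
        intro x; rw [klFun_apply, husq, Real.log_exp]; ring
      have i3 : Integrable (fun x => klFun (u n x ^ 2)) ν := by
        simp_rw [e1]; exact (i2.add (integrable_const 1)).sub i1
      rw [← ofReal_integral_eq_lintegral_ofReal i3
        (.of_forall fun x => klFun_nonneg (sq_nonneg _))]
      refine ENNReal.ofReal_le_ofReal ((le_of_eq ?_).trans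
        ((sub_le_sub_right (add_le_add_left (hray n) 1) (∫ x, Real.exp (h n x) ∂ν)).trans
          ((le_of_eq ?_).trans (hS _ (hhV n)))))
      · simp_rw [e1]
        have := integral_sub (i2.add (integrable_const 1)) i1
        simp only [Pi.add_apply] at this
        rw [this, integral_add i2 (integrable_const 1)]
        simp
      · simp only [entDual]; ring
    calc ∫⁻ x, ENNReal.ofReal (klFun (G x ^ 2)) ∂ν
        ≤ ∫⁻ x, liminf (fun i => ENNReal.ofReal (klFun (u (ns i) x ^ 2))) atTop ∂ν := by
          refine lintegral_mono_ae ?_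
          filter_upwards [hns, hae] with x hx hx'
          simp only [hx'] at hx
          have : Tendsto (fun i => ENNReal.ofReal (klFun (u (ns i) x ^ 2))) atTop
              (𝓝 (ENNReal.ofReal (klFun (G x ^ 2)))) :=
            ENNReal.tendsto_ofReal ((continuous_klFun.tendsto _).comp (hx.pow 2))
          exact this.liminf_eq.ge
      _ ≤ liminf (fun i => ∫⁻ x, ENNReal.ofReal (klFun (u (ns i) x ^ 2)) ∂ν) atTop :=
          lintegral_liminf_le fun i =>
            (measurable_klFun.comp ((hub (ns i)).1.pow_const 2)).ennreal_ofReal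
      _ ≤ liminf (fun _ : ℕ => ENNReal.ofReal S) atTop :=
          liminf_le_liminf (.of_forall fun i => hbound (ns i))
      _ = ENNReal.ofReal S := by simp

end EntropyDuality

/-! ### Disintegration, and the transport cost as a relative entropy. -/

/-- The conditional laws of a measure with a density with respect to a product measure. -/
lemma condKernel_withDensity_prod {α β : Type*} [MeasurableSpace α] [MeasurableSpace β]
    [StandardBorelSpace β] [Nonempty β] {p : Measure α} [IsFiniteMeasure p] {ν : Measure β}
    [SFinite ν] {ρ : Measure (α × β)} [IsFiniteMeasure ρ] {g : α × β → ℝ≥0∞} (hg : Measurable g)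
    (hρ : ρ = (p.prod ν).withDensity g) (hfst : ρ.fst = p) :
    ∀ᵐ x ∂p, ρ.condKernel x = ν.withDensity fun y => g (x, y) := by
  have hG : Measurable fun x => ∫⁻ y, g (x, y) ∂ν := hg.lintegral_prod_right'
  have hone : ∀ᵐ x ∂p, ∫⁻ y, g (x, y) ∂ν = 1 := by
    refine ae_eq_of_forall_setLIntegral_eq_of_sigmaFinite hG measurable_const fun s hs _ => ?_
    have : ρ.fst s = p s := by rw [hfst]
    rw [Measure.fst_apply hs, hρ, withDensity_apply _ (measurable_fst hs),
      show Prod.fst ⁻¹' s = s ×ˢ (Set.univ : Set β) by ext; simp, ← Measure.prod_restrict,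
      Measure.restrict_univ, lintegral_prod _ hg.aemeasurable] at this
    simpa using this
  have hset : MeasurableSet {x : α | ∫⁻ y, g (x, y) ∂ν = 1} := hG (measurableSet_singleton 1)
  -- Setting the density to zero on the null set of bad slices makes every slice finite, as the
  -- uniqueness of the conditional kernel requires a finite kernel.
  set g' : α → β → ℝ≥0∞ := fun x y =>
    {x : α | ∫⁻ y, g (x, y) ∂ν = 1}.indicator (fun x => g (x, y)) x with hg'
  have hg'm : Measurable (Function.uncurry g') := by
    have : Function.uncurry g'
        = ({x : α | ∫⁻ y, g (x, y) ∂ν = 1} ×ˢ (Set.univ : Set β)).indicator g := by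
      ext ⟨x, y⟩
      by_cases hx : x ∈ {x : α | ∫⁻ y, g (x, y) ∂ν = 1} <;>
        simp_all [Set.indicator]
    rw [this]
    exact hg.indicator (hset.prod .univ)
  set κ : Kernel α β := (Kernel.const α ν).withDensity g' with hκ
  have hfin : IsFiniteKernel κ := by
    refine ⟨1, by simp, fun x => ?_⟩
    rw [hκ, Kernel.withDensity_apply' _ hg'm]
    by_cases hx : x ∈ {x : α | ∫⁻ y, g (x, y) ∂ν = 1}
    · have : ∫⁻ y, g (x, y) ∂ν = 1 := hx
      simp only [hg', Set.indicator_of_mem hx, Kernel.const_apply, Measure.restrict_univ]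
      exact this.le
    · simp [hg', Set.indicator_of_notMem hx]
  have hcomp : ρ = ρ.fst ⊗ₘ κ := by
    rw [hfst, hκ, Measure.compProd_withDensity hg'm, Measure.compProd_const, hρ]
    refine withDensity_congr_ae ?_
    have hae : ∀ᵐ x ∂(p.prod ν), ∫⁻ y, g (x.1, y) ∂ν = 1 :=
      Measure.quasiMeasurePreserving_fst.ae hone
    filter_upwards [hae] with x hx
    simp only [hg']
    rw [Set.indicator_of_mem (show x.1 ∈ {x : α | ∫⁻ y, g (x, y) ∂ν = 1} from hx)]
  have huniq := eq_condKernel_of_measure_eq_compProd κ hcomp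
  rw [hfst] at huniq
  filter_upwards [huniq, hone] with x hx hx1
  rw [← hx, hκ, Kernel.withDensity_apply _ hg'm, Kernel.const_apply]
  congr 1
  ext y
  simp only [hg']
  rw [Set.indicator_of_mem (show x ∈ {x : α | ∫⁻ y, g (x, y) ∂ν = 1} from hx1)]

lemma log_heatDensity {D : ℕ} {ε : ℝ} (hε : 0 < ε) (x₀ x₁ : E D) :
    Real.log (heatDensity ε x₀ x₁)
      = -((D : ℝ) / 2 * Real.log (2 * Real.pi * ε)) - ‖x₀ - x₁‖ ^ 2 / 2 / ε := by
  rw [heatDensity, Real.log_mul (by positivity) (Real.exp_ne_zero _), Real.log_exp,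
    Real.log_rpow (by positivity)]
  field_simp
  ring

lemma integral_sub_const_sub {α : Type*} [MeasurableSpace α] {μ : Measure α}
    [IsProbabilityMeasure μ] {f g : α → ℝ} (hf : Integrable f μ) (hg : Integrable g μ) (c : ℝ) :
    ∫ x, (f x - c - g x) ∂μ = ∫ x, f x ∂μ - c - ∫ x, g x ∂μ := by
  have h : Integrable (fun x => f x - c) μ := hf.sub (integrable_const c)
  rw [integral_sub h hg, integral_sub hf (integrable_const c)]
  simp

section Density

variable {D : ℕ} {ε : ℝ} {p₀ : Measure (E D)} {ρ : Measure (E D × E D)} {e : E D × E D → ℝ}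

lemma refPlan_withDensity (he : Measurable e) :
    (refPlan ε p₀).withDensity (fun x => ENNReal.ofReal (e x))
      = (p₀.prod volume).withDensity fun x =>
        ENNReal.ofReal (heatDensity ε x.1 x.2) * ENNReal.ofReal (e x) := by
  rw [refPlan, ← withDensity_mul _ (measurable_heatDensity ε).ennreal_ofReal he.ennreal_ofReal]
  rfl

lemma ae_pos_of_density (he : Measurable e)
    (hρ : ρ = (refPlan ε p₀).withDensity fun x => ENNReal.ofReal (e x)) :
    ∀ᵐ x ∂ρ, 0 < e x := by
  rw [hρ, ae_withDensity_iff he.ennreal_ofReal]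
  exact .of_forall fun x hx => by simpa using hx

/-- The conditional log-density, in terms of the density relative to the reference plan. -/
lemma ae_logDensity_condKernel [IsProbabilityMeasure p₀] [IsProbabilityMeasure ρ] (hε : 0 < ε)
    (he : Measurable e) (hρ : ρ = (refPlan ε p₀).withDensity fun x => ENNReal.ofReal (e x))
    (hfst : ρ.fst = p₀) :
    ∀ᵐ x₀ ∂p₀, ρ.condKernel x₀ = volume.withDensity (fun x₁ =>
        ENNReal.ofReal (heatDensity ε x₀ x₁) * ENNReal.ofReal (e (x₀, x₁))) ∧
      logDensity (ρ.condKernel x₀) =ᵐ[ρ.condKernel x₀] fun x₁ => Real.log (e (x₀, x₁))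
        - (D : ℝ) / 2 * Real.log (2 * Real.pi * ε) - ‖x₀ - x₁‖ ^ 2 / 2 / ε := by
  have hm : Measurable fun x : E D × E D =>
      ENNReal.ofReal (heatDensity ε x.1 x.2) * ENNReal.ofReal (e x) :=
    (measurable_heatDensity ε).ennreal_ofReal.mul he.ennreal_ofReal
  have h1 := condKernel_withDensity_prod hm (hρ.trans (refPlan_withDensity he)) hfst
  have h2 : ∀ᵐ x₀ ∂p₀, ∀ᵐ x₁ ∂ρ.condKernel x₀, 0 < e (x₀, x₁) := by
    have := ae_pos_of_density he hρ
    rw [← ρ.disintegrate ρ.condKernel] at this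
    have := Measure.ae_ae_of_ae_compProd this
    rwa [hfst] at this
  filter_upwards [h1, h2] with x₀ h1 h2
  refine ⟨h1, ?_⟩
  have hm' : Measurable fun x₁ : E D =>
      ENNReal.ofReal (heatDensity ε x₀ x₁) * ENNReal.ofReal (e (x₀, x₁)) :=
    (measurable_heatDensity_right ε x₀).ennreal_ofReal.mul (by fun_prop)
  have h3 : (ρ.condKernel x₀).rnDeriv volume =ᵐ[ρ.condKernel x₀] fun x₁ =>
      ENNReal.ofReal (heatDensity ε x₀ x₁) * ENNReal.ofReal (e (x₀, x₁)) := by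
    have hac : ρ.condKernel x₀ ≪ volume := by
      rw [h1]; exact withDensity_absolutelyContinuous _ _
    refine hac.ae_eq ?_
    rw [h1]
    exact Measure.rnDeriv_withDensity _ hm'
  filter_upwards [h2, h3] with x₁ h2 h3
  rw [logDensity, h3, ENNReal.toReal_mul, ENNReal.toReal_ofReal (heatDensity_pos hε _ _).le,
    ENNReal.toReal_ofReal h2.le, Real.log_mul (heatDensity_pos hε _ _).ne' h2.ne',
    log_heatDensity hε]
  ring

lemma integrable_density [IsFiniteMeasure ρ] (he : Measurable e) (he0 : ∀ x, 0 ≤ e x)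
    (hρ : ρ = (refPlan ε p₀).withDensity fun x => ENNReal.ofReal (e x)) :
    Integrable e (refPlan ε p₀) := by
  refine ⟨he.aestronglyMeasurable, ?_⟩
  rw [hasFiniteIntegral_iff_ofReal (.of_forall he0)]
  have : ρ Set.univ < ∞ := measure_lt_top _ _
  rwa [hρ, withDensity_apply _ .univ, Measure.restrict_univ] at this

lemma integral_density_plan (he : Measurable e) (he0 : ∀ x, 0 ≤ e x)
    (hρ : ρ = (refPlan ε p₀).withDensity fun x => ENNReal.ofReal (e x)) (φ : E D × E D → ℝ) :
    ∫ x, φ x ∂ρ = ∫ x, e x * φ x ∂(refPlan ε p₀) := by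
  rw [hρ, integral_withDensity_eq_integral_toReal_smul he.ennreal_ofReal (by simp)]
  simp [ENNReal.toReal_ofReal (he0 _)]

lemma integrable_density_plan_iff (he : Measurable e) (he0 : ∀ x, 0 ≤ e x)
    (hρ : ρ = (refPlan ε p₀).withDensity fun x => ENNReal.ofReal (e x)) (φ : E D × E D → ℝ) :
    Integrable φ ρ ↔ Integrable (fun x => e x * φ x) (refPlan ε p₀) := by
  rw [hρ, integrable_withDensity_iff_integrable_smul' he.ennreal_ofReal (by simp)]
  simp [ENNReal.toReal_ofReal (he0 _)]

/-- Here klFun(e) = e log e + (1 − e), and 1 − e is integrable. The nonnegative form suits Fatou and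
Tonelli; the logarithmic form matches conditional entropies. -/
lemma integrable_log_density_iff [Fact (0 < ε)] [IsProbabilityMeasure p₀] [IsFiniteMeasure ρ]
    (he : Measurable e) (he0 : ∀ x, 0 ≤ e x)
    (hρ : ρ = (refPlan ε p₀).withDensity fun x => ENNReal.ofReal (e x)) :
    Integrable (fun x => Real.log (e x)) ρ ↔
      Integrable (fun x => klFun (e x)) (refPlan ε p₀) := by
  rw [integrable_density_plan_iff he he0 hρ]
  have hi := integrable_density he he0 hρ
  have h1 : Integrable (fun x => 1 - e x) (refPlan ε p₀) := (integrable_const 1).sub hi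
  have : (fun x => klFun (e x)) = fun x => e x * Real.log (e x) + (1 - e x) := by
    ext x; rw [klFun_apply]; ring
  rw [this]
  exact (integrable_add_iff_integrable_left h1).symm

lemma integral_log_density [Fact (0 < ε)] [IsProbabilityMeasure p₀] [IsProbabilityMeasure ρ]
    (he : Measurable e) (he0 : ∀ x, 0 ≤ e x)
    (hρ : ρ = (refPlan ε p₀).withDensity fun x => ENNReal.ofReal (e x))
    (hint : Integrable (fun x => Real.log (e x)) ρ) :
    ∫ x, Real.log (e x) ∂ρ = ∫ x, klFun (e x) ∂(refPlan ε p₀) := by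
  have hi := integrable_density he he0 hρ
  have h1 : ∫ x, e x ∂(refPlan ε p₀) = 1 := by
    have := integral_density_plan he he0 hρ fun _ => 1
    simpa using this.symm
  have h2 := (integrable_density_plan_iff he he0 hρ _).1 hint
  rw [integral_density_plan he he0 hρ]
  have : (fun x => klFun (e x)) = fun x => e x * Real.log (e x) + (1 - e x) := by
    ext x; rw [klFun_apply]; ring
  have h3 : Integrable (fun x => 1 - e x) (refPlan ε p₀) := (integrable_const 1).sub hi
  rw [this, integral_add h2 h3, integral_sub (integrable_const 1) hi, h1]
  simp

/-- The transport cost is integrable for every plan of finite entropy relative to the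
reference plan. -/
lemma integrable_cost_of_klFun [hε : Fact (0 < ε)] [IsProbabilityMeasure p₀]
    (he : Measurable e) (he0 : ∀ x, 0 ≤ e x)
    (hρ : ρ = (refPlan ε p₀).withDensity fun x => ENNReal.ofReal (e x))
    (hint : Integrable (fun x => klFun (e x)) (refPlan ε p₀)) :
    Integrable (fun x : E D × E D => ‖x.1 - x.2‖ ^ 2 / 2) ρ := by
  rw [integrable_density_plan_iff he he0 hρ]
  have hexp : Integrable (fun x : E D × E D => Real.exp (‖x.1 - x.2‖ ^ 2 / (4 * ε)))
      (refPlan ε p₀) := by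
    refine ⟨by fun_prop, ?_⟩
    rw [hasFiniteIntegral_iff_ofReal (.of_forall fun x => (Real.exp_pos _).le)]
    exact lintegral_exp_refPlan_lt_top hε.out p₀
  refine ((hint.add hexp).const_mul (2 * ε)).mono' (by fun_prop) (.of_forall fun x => ?_)
  have hεpos := hε.out
  rw [Real.norm_of_nonneg (mul_nonneg (he0 x) (by positivity))]
  set b := ‖x.1 - x.2‖ ^ 2 / (4 * ε) with hb
  -- Fenchel–Young for the entropy, from 1 + y ≤ e^y at y = b − log e.
  have hyoung : e x * b ≤ klFun (e x) + Real.exp b := by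
    rcases (he0 x).eq_or_lt with h | h
    · rw [← h]; simp [klFun_zero]; positivity
    · have h1 := Real.add_one_le_exp (b - Real.log (e x))
      rw [Real.exp_sub, Real.exp_log h, le_div_iff₀ h] at h1
      rw [klFun_apply]
      linarith
  have : e x * (‖x.1 - x.2‖ ^ 2 / 2) = 2 * ε * (e x * b) := by
    rw [hb]; field_simp; ring
  rw [this]
  exact mul_le_mul_of_nonneg_left hyoung (by positivity)

/-- A coupling with finite entropy relative to the reference plan has a finite transport cost,
equal up to constants to this entropy. -/
theorem hasFiniteCost_of_log_density [Fact (0 < ε)] [IsProbabilityMeasure p₀]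
    [IsProbabilityMeasure ρ] (he : Measurable e)
    (hρ : ρ = (refPlan ε p₀).withDensity fun x => ENNReal.ofReal (e x)) (hfst : ρ.fst = p₀)
    (hlog : Integrable (fun x => Real.log (e x)) ρ)
    (hcost : Integrable (fun x : E D × E D => ‖x.1 - x.2‖ ^ 2 / 2) ρ) :
    HasFiniteCost p₀ ρ ∧ eotCost ε p₀ ρ
      = ε * ∫ x, Real.log (e x) ∂ρ - ε * ((D : ℝ) / 2 * Real.log (2 * Real.pi * ε)) := by
  have hε : 0 < ε := Fact.out
  have hae := ae_logDensity_condKernel hε he hρ hfst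
  set φ : E D × E D → ℝ := fun x => Real.log (e x) - (D : ℝ) / 2 * Real.log (2 * Real.pi * ε)
    - ‖x.1 - x.2‖ ^ 2 / 2 / ε with hφ
  have hφi : Integrable φ ρ := (hlog.sub (integrable_const _)).sub (hcost.div_const ε)
  have hcond := hφi.condKernel_ae
  have hent := hφi.integral_condKernel
  have hentI := Measure.integral_condKernel hφi
  rw [hfst] at hcond hent hentI
  have hH : (fun x₀ => diffEntropy (ρ.condKernel x₀)) =ᵐ[p₀]
      fun x₀ => -∫ x₁, φ (x₀, x₁) ∂ρ.condKernel x₀ := by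
    filter_upwards [hae] with x₀ h
    rw [diffEntropy, integral_congr_ae h.2]
  refine ⟨⟨hcost, ?_, ?_, ?_⟩, ?_⟩
  · filter_upwards [hae] with x₀ h
    rw [h.1]; exact withDensity_absolutelyContinuous _ _
  · filter_upwards [hae, hcond] with x₀ h h'
    exact h'.congr h.2.symm
  · exact hent.neg.congr hH.symm
  -- The transport cost cancels against ε times the last term of `φ`.
  · rw [eotCost, integral_congr_ae hH, integral_neg, hentI, hφ,
      integral_sub_const_sub hlog (hcost.div_const ε), integral_div ε]
    field_simp
    ring

/-- A coupling of finite transport cost has a density with respect to the reference plan, with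
integrable logarithm. -/
theorem HasFiniteCost.exists_log_density [Fact (0 < ε)] [IsProbabilityMeasure p₀]
    [IsProbabilityMeasure ρ] (h : HasFiniteCost p₀ ρ) (hfst : ρ.fst = p₀) :
    ∃ e : E D × E D → ℝ, Measurable e ∧ (∀ x, 0 ≤ e x) ∧
      ρ = (refPlan ε p₀).withDensity (fun x => ENNReal.ofReal (e x)) ∧
      Integrable (fun x => Real.log (e x)) ρ := by
  have hε : 0 < ε := Fact.out
  have hac : ρ ≪ p₀.prod volume := by
    rw [← ρ.disintegrate ρ.condKernel, hfst, ← Measure.compProd_const]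
    exact Measure.AbsolutelyContinuous.compProd_right h.density
  have hacR : p₀.prod volume ≪ refPlan ε p₀ := by
    refine withDensity_absolutelyContinuous' (measurable_heatDensity ε).ennreal_ofReal.aemeasurable
      (.of_forall fun x => ?_)
    simpa using heatDensity_pos hε x.1 x.2
  set e : E D × E D → ℝ := fun x => (ρ.rnDeriv (refPlan ε p₀) x).toReal with he_def
  have he : Measurable e := (Measure.measurable_rnDeriv _ _).ennreal_toReal
  have he0 : ∀ x, 0 ≤ e x := fun x => ENNReal.toReal_nonneg
  have hρ : ρ = (refPlan ε p₀).withDensity (fun x => ENNReal.ofReal (e x)) := by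
    conv_lhs => rw [← Measure.withDensity_rnDeriv_eq _ _ (hac.trans hacR)]
    refine withDensity_congr_ae ?_
    filter_upwards [Measure.rnDeriv_lt_top ρ (refPlan ε p₀)] with x hx
    rw [he_def, ENNReal.ofReal_toReal hx.ne]
  refine ⟨e, he, he0, hρ, ?_⟩
  rw [integrable_log_density_iff he he0 hρ]
  refine ⟨(measurable_klFun.comp he).aestronglyMeasurable, ?_⟩
  rw [hasFiniteIntegral_iff_ofReal (.of_forall fun x => klFun_nonneg (he0 x)),
    lintegral_refPlan _ _ (F := fun x => ENNReal.ofReal (klFun (e x)))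
      (measurable_klFun.comp he).ennreal_ofReal]
  have hcond := h.cost.condKernel_ae
  have hci := h.cost.integral_condKernel
  rw [hfst] at hcond hci
  -- For fixed x₀ the left side is the entropy of the conditional law relative to N(x₀, εI). Using
  -- the nonnegative integrand reduces joint integrability to that of the x₀-function on the right,
  -- which the finite cost supplies.
  have hbd : ∀ᵐ x₀ ∂p₀, ∫⁻ x₁, ENNReal.ofReal (heatDensity ε x₀ x₁) *
      ENNReal.ofReal (klFun (e (x₀, x₁))) = ENNReal.ofReal (-diffEntropy (ρ.condKernel x₀)
        + (D : ℝ) / 2 * Real.log (2 * Real.pi * ε)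
        + (∫ x₁, ‖x₀ - x₁‖ ^ 2 / 2 ∂ρ.condKernel x₀) / ε) := by
    filter_upwards [hcond, h.logDensity, ae_logDensity_condKernel hε he hρ hfst] with x₀ h1 h2 h3
    obtain ⟨h3, h4⟩ := h3
    have hheat : Measurable (heatDensity ε x₀) := measurable_heatDensity_right ε x₀
    have hex : Measurable fun x₁ => e (x₀, x₁) := he.comp measurable_prodMk_left
    have hw : ρ.condKernel x₀ = volume.withDensity (fun x₁ =>
        ENNReal.ofReal (heatDensity ε x₀ x₁ * e (x₀, x₁))) := by
      rw [h3]; simp_rw [ENNReal.ofReal_mul (heatDensity_pos hε x₀ _).le]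
    have hwm : Measurable fun x₁ => heatDensity ε x₀ x₁ * e (x₀, x₁) := hheat.mul hex
    have hw0 : ∀ x₁, 0 ≤ heatDensity ε x₀ x₁ * e (x₀, x₁) := fun x₁ =>
      mul_nonneg (heatDensity_pos hε x₀ _).le (he0 _)
    have hlogI : Integrable (fun x₁ => Real.log (e (x₀, x₁))) (ρ.condKernel x₀) := by
      refine ((h2.add (integrable_const ((D : ℝ) / 2 * Real.log (2 * Real.pi * ε)))).add
        (h1.div_const ε)).congr ?_
      filter_upwards [h4] with x₁ h4
      simp only [Pi.add_apply, h4]; ring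
    have hlogV : ∫ x₁, Real.log (e (x₀, x₁)) ∂ρ.condKernel x₀
        = -diffEntropy (ρ.condKernel x₀) + (D : ℝ) / 2 * Real.log (2 * Real.pi * ε)
        + (∫ x₁, ‖x₀ - x₁‖ ^ 2 / 2 ∂ρ.condKernel x₀) / ε := by
      rw [diffEntropy, integral_congr_ae h4,
        integral_sub_const_sub hlogI (h1.div_const ε), integral_div ε]
      ring
    have i1 : Integrable (heatDensity ε x₀) := by
      refine ⟨hheat.aestronglyMeasurable, ?_⟩
      rw [hasFiniteIntegral_iff_ofReal (.of_forall fun x => (heatDensity_pos hε x₀ x).le),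
        lintegral_heatDensity hε]
      simp
    have v1 : ∫ x₁, heatDensity ε x₀ x₁ = 1 := by
      rw [integral_eq_lintegral_of_nonneg_ae (.of_forall fun x => (heatDensity_pos hε x₀ x).le)
        hheat.aestronglyMeasurable, lintegral_heatDensity hε]
      simp
    have hmass : ∫⁻ x₁, ENNReal.ofReal (heatDensity ε x₀ x₁ * e (x₀, x₁)) = 1 := by
      have : ρ.condKernel x₀ Set.univ = 1 := measure_univ
      rwa [hw, withDensity_apply _ .univ, Measure.restrict_univ] at this
    have i2 : Integrable (fun x₁ => heatDensity ε x₀ x₁ * e (x₀, x₁)) := by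
      refine ⟨hwm.aestronglyMeasurable, ?_⟩
      rw [hasFiniteIntegral_iff_ofReal (.of_forall hw0), hmass]
      simp
    have v2 : ∫ x₁, heatDensity ε x₀ x₁ * e (x₀, x₁) = 1 := by
      rw [integral_eq_lintegral_of_nonneg_ae (.of_forall hw0)
        hwm.aestronglyMeasurable, hmass]
      simp
    have i12 : Integrable (fun x₁ => heatDensity ε x₀ x₁ - heatDensity ε x₀ x₁ * e (x₀, x₁)) :=
      i1.sub i2
    have i3 : Integrable (fun x₁ =>
        heatDensity ε x₀ x₁ * e (x₀, x₁) * Real.log (e (x₀, x₁))) := by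
      rw [hw, integrable_withDensity_iff_integrable_smul' hwm.ennreal_ofReal
        (by simp)] at hlogI
      simpa [ENNReal.toReal_ofReal (hw0 _)] using hlogI
    have v3 : ∫ x₁, heatDensity ε x₀ x₁ * e (x₀, x₁) * Real.log (e (x₀, x₁))
        = ∫ x₁, Real.log (e (x₀, x₁)) ∂ρ.condKernel x₀ := by
      rw [hw, integral_withDensity_eq_integral_toReal_smul hwm.ennreal_ofReal
        (by simp)]
      simp [ENNReal.toReal_ofReal (hw0 _)]
    rw [← hlogV, ← v3]
    simp_rw [← ENNReal.ofReal_mul (heatDensity_pos hε x₀ _).le]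
    have hexp : ∀ x₁, heatDensity ε x₀ x₁ * klFun (e (x₀, x₁))
        = heatDensity ε x₀ x₁ * e (x₀, x₁) * Real.log (e (x₀, x₁))
          + (heatDensity ε x₀ x₁ - heatDensity ε x₀ x₁ * e (x₀, x₁)) := by
      intro x₁; rw [klFun_apply]; ring
    have i4 : Integrable (fun x₁ => heatDensity ε x₀ x₁ * klFun (e (x₀, x₁))) := by
      simp_rw [hexp]; exact i3.add i12
    rw [← ofReal_integral_eq_lintegral_ofReal i4 (.of_forall fun x₁ =>
      mul_nonneg (heatDensity_pos hε x₀ x₁).le (klFun_nonneg (he0 _)))]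
    congr 1
    simp_rw [hexp]
    rw [integral_add i3 i12, integral_sub i1 i2, v1, v2]
    simp
  rw [lintegral_congr_ae hbd]
  exact ((h.entropy.neg.add (integrable_const _)).add (hci.div_const ε)).lintegral_lt_top

end Density

/-! ### The dual objective as an integral over the reference plan. -/

section DualLoss

variable {D : ℕ} {ε : ℝ} {p₀ p₁ : Measure (E D)} {f ξ : E D → ℝ}

lemma lintegral_exp_eq_refPlan [SFinite p₀] (hε : 0 < ε) (hf : Measurable f) (hξ : Measurable ξ) :
    ∫⁻ x₀, ∫⁻ z, ENNReal.ofReal (Real.exp (f (x₀ + Real.sqrt ε • z) / ε - ξ x₀))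
        ∂(stdGaussian (E D)) ∂p₀
      = ∫⁻ x, ENNReal.ofReal (Real.exp (f x.2 / ε - ξ x.1)) ∂(refPlan ε p₀) := by
  rw [lintegral_refPlan ε p₀ (F := fun x => ENNReal.ofReal (Real.exp (f x.2 / ε - ξ x.1)))
    (by fun_prop)]
  refine lintegral_congr fun x₀ => ?_
  exact lintegral_stdGaussian_add hε
    (F := fun x₁ => ENNReal.ofReal (Real.exp (f x₁ / ε - ξ x₀))) (by fun_prop) x₀

lemma integrable_exp_iff {α : Type*} [MeasurableSpace α] {μ : Measure α} {h : α → ℝ}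
    (hh : Measurable h) : Integrable (fun x => Real.exp (h x)) μ ↔
      ∫⁻ x, ENNReal.ofReal (Real.exp (h x)) ∂μ ≠ ∞ := by
  rw [← lt_top_iff_ne_top,
    ← hasFiniteIntegral_iff_ofReal (.of_forall fun x => (Real.exp_pos (h x)).le)]
  exact ⟨fun h => h.2, fun h => ⟨hh.exp.aestronglyMeasurable, h⟩⟩

lemma dualLoss_of_integrable [SFinite p₀] (hε : 0 < ε) (hf : Measurable f) (hξ : Measurable ξ)
    (h : Integrable (fun x => Real.exp (f x.2 / ε - ξ x.1)) (refPlan ε p₀)) :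
    dualLoss ε p₀ p₁ f ξ = ((dualConst D ε + (∫ x₁, f x₁ ∂p₁) - ε * ∫ x₀, ξ x₀ ∂p₀
      - ε * ∫ x, Real.exp (f x.2 / ε - ξ x.1) ∂(refPlan ε p₀) : ℝ) : EReal) := by
  rw [dualLoss, lintegral_exp_eq_refPlan hε hf hξ, ← ofReal_integral_eq_lintegral_ofReal h
    (.of_forall fun x => (Real.exp_pos _).le), EReal.coe_ennreal_ofReal,
    max_eq_left (integral_nonneg fun x => (Real.exp_pos _).le)]
  push_cast
  rfl

lemma dualLoss_of_not_integrable [SFinite p₀] (hε : 0 < ε) (hf : Measurable f) (hξ : Measurable ξ)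
    (h : ¬ Integrable (fun x => Real.exp (f x.2 / ε - ξ x.1)) (refPlan ε p₀)) :
    dualLoss ε p₀ p₁ f ξ = ⊥ := by
  rw [integrable_exp_iff (by fun_prop), not_not] at h
  rw [dualLoss, lintegral_exp_eq_refPlan hε hf hξ, h, EReal.coe_ennreal_top,
    EReal.coe_mul_top_of_pos hε, EReal.sub_top]

lemma dualLoss_le_dualValue (hf : f ∈ integrableFns p₁) (hξ : ξ ∈ integrableFns p₀) :
    dualLoss ε p₀ p₁ f ξ ≤ dualValue ε p₀ p₁ :=
  (le_iSup₂ (f := fun ξ (_ : ξ ∈ integrableFns p₀) => dualLoss ε p₀ p₁ f ξ) ξ hξ).trans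
    (le_iSup₂ (f := fun f (_ : f ∈ integrableFns p₁) =>
      ⨆ ξ ∈ integrableFns p₀, dualLoss ε p₀ p₁ f ξ) f hf)

end DualLoss

/-! ### Strong duality. -/

lemma integral_comp_fst {α β : Type*} [MeasurableSpace α] [MeasurableSpace β] {π : Measure (α × β)}
    {φ : α → ℝ} (hφ : Measurable φ) : ∫ x, φ x.1 ∂π = ∫ x, φ x ∂π.fst :=
  (integral_map measurable_fst.aemeasurable hφ.aestronglyMeasurable).symm

lemma integral_comp_snd {α β : Type*} [MeasurableSpace α] [MeasurableSpace β] {π : Measure (α × β)}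
    {φ : β → ℝ} (hφ : Measurable φ) : ∫ x, φ x.2 ∂π = ∫ x, φ x ∂π.snd :=
  (integral_map measurable_snd.aemeasurable hφ.aestronglyMeasurable).symm

/-- The functions `φ(x₁) + ψ(x₀)` with `φ`, `ψ` bounded and measurable. -/
def sumFns (D : ℕ) : Submodule ℝ (E D × E D → ℝ) :=
  (boundedFns (E D)).map (LinearMap.funLeft ℝ ℝ Prod.snd) ⊔
    (boundedFns (E D)).map (LinearMap.funLeft ℝ ℝ Prod.fst)

lemma mem_sumFns {D : ℕ} {h : E D × E D → ℝ} : h ∈ sumFns D ↔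
    ∃ φ ∈ boundedFns (E D), ∃ ψ ∈ boundedFns (E D), h = fun x => φ x.2 + ψ x.1 := by
  simp only [sumFns, Submodule.mem_sup, Submodule.mem_map]
  constructor
  · rintro ⟨_, ⟨φ, hφ, rfl⟩, _, ⟨ψ, hψ, rfl⟩, rfl⟩
    exact ⟨φ, hφ, ψ, hψ, rfl⟩
  · rintro ⟨φ, hφ, ψ, hψ, rfl⟩
    exact ⟨_, ⟨φ, hφ, rfl⟩, _, ⟨ψ, hψ, rfl⟩, rfl⟩

lemma sumFns_le (D : ℕ) : sumFns D ≤ boundedFns (E D × E D) := by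
  intro h hh
  obtain ⟨φ, ⟨hφ, C, hC⟩, ψ, ⟨hψ, C', hC'⟩, rfl⟩ := mem_sumFns.1 hh
  exact ⟨by fun_prop, C + C',
    fun x => (abs_add_le _ _).trans (add_le_add (hC x.2) (hC' x.1))⟩

lemma indicator_one_mem_boundedFns {α : Type*} [MeasurableSpace α] {s : Set α}
    (hs : MeasurableSet s) : s.indicator (fun _ => (1 : ℝ)) ∈ boundedFns α := by
  refine ⟨measurable_const.indicator hs, 1, fun x => ?_⟩
  by_cases h : x ∈ s <;> simp [h]

lemma map_eq_of_integral_indicator {α β : Type*} [MeasurableSpace α] [MeasurableSpace β]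
    {π ρ : Measure α} [IsFiniteMeasure π] [IsFiniteMeasure ρ] {q : α → β} (hq : Measurable q)
    (h : ∀ s, MeasurableSet s → ∫ x, s.indicator (fun _ => (1 : ℝ)) (q x) ∂ρ
      = ∫ x, s.indicator (fun _ => (1 : ℝ)) (q x) ∂π) : ρ.map q = π.map q := by
  ext s hs
  have hs' := hq hs
  have key : ∀ μ : Measure α, ∫ x, s.indicator (fun _ => (1 : ℝ)) (q x) ∂μ = μ.real (q ⁻¹' s) := by
    intro μ
    rw [← integral_indicator_one hs']
    rfl
  have := h s hs
  rw [key, key] at this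
  rw [Measure.map_apply hq hs, Measure.map_apply hq hs]
  exact (measureReal_eq_measureReal_iff (by finiteness) (by finiteness)).1 this

/-- Strong duality: the primal value is at most the dual value. -/
theorem IsEOTPlan.eotCost_le_dualValue {D : ℕ} {ε : ℝ} [Fact (0 < ε)] {p₀ p₁ : Measure (E D)}
    [IsProbabilityMeasure p₀] [IsProbabilityMeasure p₁] {π : Measure (E D × E D)}
    [IsProbabilityMeasure π] (hπ : IsEOTPlan ε p₀ p₁ π) :
    (eotCost ε p₀ π : EReal) ≤ dualValue ε p₀ p₁ := by
  have hε : 0 < ε := Fact.out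
  obtain ⟨⟨hfst, hsnd⟩, -, hopt⟩ := hπ
  rcases eq_or_ne (dualValue ε p₀ p₁) ⊤ with htop | htop
  · rw [htop]; exact le_top
  set κ : ℝ := (D : ℝ) / 2 * Real.log (2 * Real.pi * ε) with hκ
  -- Chosen so that εS − εκ is the dual value; `entDual` at φ(x₁) + ψ(x₀) corresponds to the
  -- potentials f = εφ and ξ = −ψ.
  set S : ℝ := ((dualValue ε p₀ p₁).toReal + ε * κ) / ε with hS
  have hent : ∀ h ∈ sumFns D, entDual (refPlan ε p₀) π h ≤ S := by
    intro h hh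
    have hhb := sumFns_le D hh
    obtain ⟨φ, hφ, ψ, hψ, rfl⟩ := mem_sumFns.1 hh
    have hεφ : ε • φ ∈ integrableFns p₁ := ⟨hφ.1.const_smul ε,
      integrable_of_mem_boundedFns ((boundedFns _).smul_mem ε hφ)⟩
    have hnψ : -ψ ∈ integrableFns p₀ := ⟨hψ.1.neg,
      integrable_of_mem_boundedFns ((boundedFns _).neg_mem hψ)⟩
    have hle := dualLoss_le_dualValue (ε := ε) hεφ hnψ
    have hexp : (fun x : E D × E D => Real.exp ((ε • φ) x.2 / ε - (-ψ) x.1))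
        = fun x => Real.exp (φ x.2 + ψ x.1) := by
      ext x
      simp only [Pi.smul_apply, Pi.neg_apply, smul_eq_mul, sub_neg_eq_add]
      rw [mul_div_cancel_left₀ _ hε.ne']
    have hint : Integrable (fun x : E D × E D => Real.exp (φ x.2 + ψ x.1)) (refPlan ε p₀) :=
      integrable_of_mem_boundedFns (exp_mem_boundedFns hhb)
    rw [dualLoss_of_integrable hε hεφ.1 hnψ.1 (hexp ▸ hint), hexp] at hle
    have hreal := EReal.toReal_le_toReal hle (EReal.coe_ne_bot _) htop
    rw [EReal.toReal_coe] at hreal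
    have h1 : ∫ x, (φ x.2 + ψ x.1) ∂π = ∫ x, φ x ∂p₁ + ∫ x, ψ x ∂p₀ := by
      rw [← hfst, ← hsnd, ← integral_comp_fst hψ.1, ← integral_comp_snd hφ.1]
      refine integral_add (integrable_of_mem_boundedFns ⟨hφ.1.comp measurable_snd, ?_⟩)
        (integrable_of_mem_boundedFns ⟨hψ.1.comp measurable_fst, ?_⟩)
      · exact hφ.2.imp fun C hC x => hC x.2
      · exact hψ.2.imp fun C hC x => hC x.1
    rw [entDual, h1, hS, le_div_iff₀ hε]
    simp only [Pi.smul_apply, Pi.neg_apply, smul_eq_mul, integral_const_mul, integral_neg,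
      dualConst, ← hκ] at hreal
    linarith
  obtain ⟨g, hgm, hg2, hgV, hgS⟩ :=
    exists_sq_density_of_entDual_le (refPlan ε p₀) π (sumFns D) (sumFns_le D) hent
  have hS0 : 0 ≤ S := by
    have := hent 0 (sumFns D).zero_mem
    simpa [entDual] using this
  set e : E D × E D → ℝ := fun x => g x ^ 2 with he_def
  have he : Measurable e := hgm.pow_const 2
  have he0 : ∀ x, 0 ≤ e x := fun x => sq_nonneg _
  set ρ := (refPlan ε p₀).withDensity (fun x => ENNReal.ofReal (e x)) with hρ
  have hρfin : IsFiniteMeasure ρ := isFiniteMeasure_withDensity_ofReal hg2.integrable_sq.2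
  -- Indicators of either coordinate belong to `sumFns`, so these identities force both marginals,
  -- and ρ becomes a competitor of π.
  have hρV : ∀ h ∈ sumFns D, ∫ x, h x ∂ρ = ∫ x, h x ∂π := by
    intro h hh
    rw [← hgV h hh, integral_density_plan he he0 hρ]
    simp_rw [mul_comm, he_def]
  have hfst' : ρ.fst = p₀ := by
    rw [← hfst]
    refine map_eq_of_integral_indicator measurable_fst fun s hs => hρV _ ?_
    exact mem_sumFns.2 ⟨0, (boundedFns _).zero_mem, _, indicator_one_mem_boundedFns hs, by simp⟩
  have hsnd' : ρ.snd = p₁ := by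
    rw [← hsnd]
    refine map_eq_of_integral_indicator measurable_snd fun s hs => hρV _ ?_
    exact mem_sumFns.2 ⟨_, indicator_one_mem_boundedFns hs, 0, (boundedFns _).zero_mem, by simp⟩
  have hρprob : IsProbabilityMeasure ρ := ⟨by rw [← Measure.fst_univ, hfst', measure_univ]⟩
  have hkl : Integrable (fun x => klFun (e x)) (refPlan ε p₀) := by
    refine ⟨(measurable_klFun.comp he).aestronglyMeasurable, ?_⟩
    rw [hasFiniteIntegral_iff_ofReal (.of_forall fun x => klFun_nonneg (he0 x))]
    exact hgS.trans_lt ENNReal.ofReal_lt_top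
  have hklS : ∫ x, klFun (e x) ∂(refPlan ε p₀) ≤ S := by
    rw [integral_eq_lintegral_of_nonneg_ae (.of_forall fun x => klFun_nonneg (he0 x)) hkl.1]
    exact ENNReal.toReal_le_of_le_ofReal hS0 hgS
  have hlog := (integrable_log_density_iff he he0 hρ).2 hkl
  obtain ⟨hfc, hval⟩ := hasFiniteCost_of_log_density he hρ hfst' hlog
    (integrable_cost_of_klFun he he0 hρ hkl)
  have hle := hopt ρ ⟨hfst', hsnd'⟩ hfc
  rw [hval, integral_log_density he he0 hρ hlog, ← hκ] at hle
  have hfinal : eotCost ε p₀ π ≤ (dualValue ε p₀ p₁).toReal := by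
    have h2 : ε * S = (dualValue ε p₀ p₁).toReal + ε * κ := by rw [hS]; field_simp
    nlinarith [mul_le_mul_of_nonneg_left hklS hε.le]
  refine (EReal.coe_le_coe_iff.2 hfinal).trans_eq (EReal.coe_toReal htop ?_)
  -- The zero potentials have a real dual value, so L* is not −∞ and `toReal` loses nothing.
  intro hbot
  have h0 := dualLoss_le_dualValue (ε := ε) (p₀ := p₀) (p₁ := p₁)
    (f := fun _ => 0) (ξ := fun _ => 0)
    ⟨measurable_const, integrable_const _⟩ ⟨measurable_const, integrable_const _⟩
  rw [dualLoss_of_integrable hε measurable_const measurable_const (by simp), hbot] at h0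
  exact EReal.coe_ne_bot _ (le_bot_iff.1 h0)

/-! ### Recovered plans and the duality gap. -/

section Plan

variable {D : ℕ} {ε : ℝ} {p₀ p₁ : Measure (E D)} {f ξ : E D → ℝ}

lemma measurable_optAux (hf : Measurable f) : Measurable (optAux ε f) := by
  have hg : Measurable fun x : E D × E D => gibbs ε f x.1 x.2 := by
    unfold gibbs; fun_prop
  have : Measurable (partitionFn ε f) :=
    (hg.stronglyMeasurable.integral_prod_right' (ν := volume)).measurable
  unfold optAux
  fun_prop

lemma rpow_mul_gibbs (hε : 0 < ε) (x₀ x₁ : E D) :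
    (2 * Real.pi * ε) ^ (-((D : ℝ) / 2)) * gibbs ε f x₀ x₁
      = heatDensity ε x₀ x₁ * Real.exp (f x₁ / ε) := by
  rw [heatDensity, gibbs, mul_assoc _ (Real.exp _) (Real.exp _), ← Real.exp_add]
  congr 2
  field_simp
  ring

/-- Integrability is essential: otherwise the integral and its logarithm take the default value 0.
-/
lemma exp_optAux (hε : 0 < ε) {x₀ : E D} (h : Integrable (gibbs ε f x₀)) :
    Real.exp (optAux ε f x₀)
      = (2 * Real.pi * ε) ^ (-((D : ℝ) / 2)) * partitionFn ε f x₀ := by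
  have hpos : 0 < partitionFn ε f x₀ := by
    rw [partitionFn, integral_pos_iff_support_of_nonneg (f := gibbs ε f x₀)
      (fun x => (Real.exp_pos _).le) h]
    have : Function.support (gibbs ε f x₀) = Set.univ := by
      ext x; simp [gibbs, Real.exp_ne_zero]
    rw [this]
    exact Measure.measure_univ_pos.2 (NeZero.ne _)
  have h2 : 0 < 2 * Real.pi * ε := by positivity
  rw [optAux, Real.exp_sub, Real.exp_log hpos, Real.rpow_neg h2.le, Real.rpow_def_of_pos h2,
    mul_comm (Real.log _)]
  field_simp

/-- Integrating out x₁ turns e^{f/ε} into its Gaussian mean e^{ξ_f}. The identity in [0, ∞] needs no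
integrability of ξ. -/
lemma lintegral_exp_sub_refPlan [SFinite p₀] (hε : 0 < ε) (hf : Measurable f)
    (hξ : Measurable ξ) (hZ : ∀ᵐ x₀ ∂p₀, Integrable (gibbs ε f x₀)) :
    ∫⁻ x, ENNReal.ofReal (Real.exp (f x.2 / ε - ξ x.1)) ∂(refPlan ε p₀)
      = ∫⁻ x₀, ENNReal.ofReal (Real.exp (optAux ε f x₀ - ξ x₀)) ∂p₀ := by
  rw [lintegral_refPlan ε p₀ (F := fun x => ENNReal.ofReal (Real.exp (f x.2 / ε - ξ x.1)))
    (by fun_prop)]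
  refine lintegral_congr_ae ?_
  filter_upwards [hZ] with x₀ h
  have e1 : ∀ x₁, ENNReal.ofReal (heatDensity ε x₀ x₁)
      * ENNReal.ofReal (Real.exp (f x₁ / ε - ξ x₀))
      = ENNReal.ofReal ((2 * Real.pi * ε) ^ (-((D : ℝ) / 2)) / Real.exp (ξ x₀))
        * ENNReal.ofReal (gibbs ε f x₀ x₁) := by
    intro x₁
    rw [← ENNReal.ofReal_mul (heatDensity_pos hε _ _).le, ← ENNReal.ofReal_mul (by positivity),
      Real.exp_sub, div_mul_eq_mul_div, rpow_mul_gibbs hε, mul_div_assoc]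
  simp_rw [e1]
  rw [lintegral_const_mul' _ _ (by simp), ← ofReal_integral_eq_lintegral_ofReal h
    (.of_forall fun x => (Real.exp_pos _).le), ← ENNReal.ofReal_mul (by positivity), Real.exp_sub,
    exp_optAux hε h, div_mul_eq_mul_div]
  rfl

lemma plan_eq_refPlan_withDensity (hε : 0 < ε) (hf : Measurable f) :
    plan ε p₀ f = (refPlan ε p₀).withDensity fun x =>
      ENNReal.ofReal (Real.exp (f x.2 / ε - optAux ε f x.1)) := by
  have := measurable_optAux (ε := ε) hf
  rw [refPlan_withDensity (by fun_prop), plan, planAux]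
  congr 1
  ext x
  rw [← ENNReal.ofReal_mul (heatDensity_pos hε _ _).le, Real.exp_sub, div_mul_eq_mul_div,
    rpow_mul_gibbs hε, mul_div_assoc]

lemma lintegral_exp_optAux_refPlan [IsProbabilityMeasure p₀] (hε : 0 < ε) (hf : Measurable f)
    (hZ : ∀ᵐ x₀ ∂p₀, Integrable (gibbs ε f x₀)) :
    ∫⁻ x, ENNReal.ofReal (Real.exp (f x.2 / ε - optAux ε f x.1)) ∂(refPlan ε p₀) = 1 := by
  rw [lintegral_exp_sub_refPlan hε hf (measurable_optAux hf) hZ]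
  simp

lemma isProbabilityMeasure_plan [IsProbabilityMeasure p₀] (hε : 0 < ε) (hf : Measurable f)
    (hZ : ∀ᵐ x₀ ∂p₀, Integrable (gibbs ε f x₀)) : IsProbabilityMeasure (plan ε p₀ f) :=
  ⟨by rw [plan_eq_refPlan_withDensity hε hf, withDensity_apply _ .univ, Measure.restrict_univ,
    lintegral_exp_optAux_refPlan hε hf hZ]⟩

/-- Integrals of `exp (ξ_f - ξ)` and of the density of `π^{f,ξ}`. -/
lemma integral_exp_sub_refPlan [SFinite p₀] (hε : 0 < ε) (hf : Measurable f)
    (hξ : Measurable ξ) (hZ : ∀ᵐ x₀ ∂p₀, Integrable (gibbs ε f x₀))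
    (h : Integrable (fun x => Real.exp (f x.2 / ε - ξ x.1)) (refPlan ε p₀)) :
    Integrable (fun x₀ => Real.exp (optAux ε f x₀ - ξ x₀)) p₀ ∧
    ∫ x, Real.exp (f x.2 / ε - ξ x.1) ∂(refPlan ε p₀)
      = ∫ x₀, Real.exp (optAux ε f x₀ - ξ x₀) ∂p₀ := by
  have hm := measurable_optAux (ε := ε) hf
  have key := lintegral_exp_sub_refPlan hε hf hξ hZ
  have h2 : Integrable (fun x₀ => Real.exp (optAux ε f x₀ - ξ x₀)) p₀ := by
    rw [integrable_exp_iff (by fun_prop)] at h ⊢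
    rwa [key] at h
  refine ⟨h2, ?_⟩
  rw [integral_eq_lintegral_of_nonneg_ae (.of_forall fun x => (Real.exp_pos _).le) h.1, key,
    ← integral_eq_lintegral_of_nonneg_ae (.of_forall fun x => (Real.exp_pos _).le) h2.1]

/-- This is 1 + x ≤ e^x at x = ξ_f − ξ, integrated; it expresses the optimality of ξ_f. -/
lemma integral_optAux_le [IsProbabilityMeasure p₀] (hξi : Integrable ξ p₀)
    (hoi : Integrable (optAux ε f) p₀)
    (h : Integrable (fun x₀ => Real.exp (optAux ε f x₀ - ξ x₀)) p₀) :
    ∫ x₀, optAux ε f x₀ ∂p₀ ≤ ∫ x₀, ξ x₀ ∂p₀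
      + ∫ x₀, Real.exp (optAux ε f x₀ - ξ x₀) ∂p₀ - 1 := by
  have h1 : ∫ x₀, (optAux ε f x₀ - ξ x₀ + 1) ∂p₀ ≤ ∫ x₀, Real.exp (optAux ε f x₀ - ξ x₀) ∂p₀ :=
    integral_mono ((hoi.sub hξi).add (integrable_const 1)) h fun x => Real.add_one_le_exp _
  have h2 : Integrable (fun x₀ => optAux ε f x₀ - ξ x₀) p₀ := hoi.sub hξi
  rw [integral_add h2 (integrable_const 1), integral_sub hoi hξi] at h1
  simp at h1
  linarith

/-- The auxiliary function `ξ_f` is optimal for `f`. -/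
theorem dualLoss_le_dualLoss_optAux [IsProbabilityMeasure p₀] (hε : 0 < ε) (hf : Measurable f)
    (hZ : ∀ᵐ x₀ ∂p₀, Integrable (gibbs ε f x₀)) (hξ : ξ ∈ integrableFns p₀)
    (hoi : Integrable (optAux ε f) p₀) :
    dualLoss ε p₀ p₁ f ξ ≤ dualLoss ε p₀ p₁ f (optAux ε f) := by
  have hm := measurable_optAux (ε := ε) hf
  by_cases h : Integrable (fun x => Real.exp (f x.2 / ε - ξ x.1)) (refPlan ε p₀)
  · have h1 : Integrable (fun x => Real.exp (f x.2 / ε - optAux ε f x.1)) (refPlan ε p₀) := by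
      rw [integrable_exp_iff (by fun_prop), lintegral_exp_optAux_refPlan hε hf hZ]; simp
    obtain ⟨h2, h3⟩ := integral_exp_sub_refPlan hε hf hξ.1 hZ h
    have h4 : ∫ x, Real.exp (f x.2 / ε - optAux ε f x.1) ∂(refPlan ε p₀) = 1 := by
      rw [(integral_exp_sub_refPlan hε hf hm hZ h1).2]; simp
    rw [dualLoss_of_integrable hε hf hξ.1 h, dualLoss_of_integrable hε hf hm h1, h3, h4,
      EReal.coe_le_coe_iff]
    have h5 := mul_le_mul_of_nonneg_left (integral_optAux_le hξ.2 hoi h2) hε.le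
    linarith
  · rw [dualLoss_of_not_integrable hε hf hξ.1 h]; exact bot_le

/-- Integrability of `ξ_f`, from a plan of finite entropy. -/
lemma integrable_optAux {π : Measure (E D × E D)} {e : E D × E D → ℝ} [Fact (0 < ε)]
    [IsProbabilityMeasure p₀] [IsProbabilityMeasure π] (hfst : π.fst = p₀) (hsnd : π.snd = p₁)
    (he : Measurable e) (he0 : ∀ x, 0 ≤ e x)
    (hπ : π = (refPlan ε p₀).withDensity fun x => ENNReal.ofReal (e x))
    (hlog : Integrable (fun x => Real.log (e x)) π) (hf : f ∈ integrableFns p₁)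
    (hξ : ξ ∈ integrableFns p₀) (hZ : ∀ᵐ x₀ ∂p₀, Integrable (gibbs ε f x₀))
    (h : Integrable (fun x => Real.exp (f x.2 / ε - ξ x.1)) (refPlan ε p₀)) :
    Integrable (optAux ε f) p₀ := by
  have hε : 0 < ε := Fact.out
  obtain ⟨hfm, hfi⟩ := hf
  obtain ⟨hξm, hξi⟩ := hξ
  have hm := measurable_optAux (ε := ε) hfm
  have hup := (integral_exp_sub_refPlan hε hfm hξm hZ h).1
  have hv : Integrable (fun x => Real.exp (f x.2 / ε - optAux ε f x.1)) (refPlan ε p₀) := by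
    rw [integrable_exp_iff (by fun_prop), lintegral_exp_optAux_refPlan hε hfm hZ]; simp
  have mpf : MeasurePreserving Prod.fst π p₀ := ⟨measurable_fst, hfst⟩
  have mps : MeasurePreserving Prod.snd π p₁ := ⟨measurable_snd, hsnd⟩
  have hup' : Integrable (fun x : E D × E D => Real.exp (optAux ε f x.1 - ξ x.1)) π :=
    mpf.integrable_comp_of_integrable hup
  have hfi' : Integrable (fun x : E D × E D => f x.2) π := mps.integrable_comp_of_integrable hfi
  have hξi' : Integrable (fun x : E D × E D => ξ x.1) π := mpf.integrable_comp_of_integrable hξi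
  have hve : Integrable (fun x => Real.exp (f x.2 / ε - optAux ε f x.1) / e x) π := by
    rw [integrable_density_plan_iff he he0 hπ]
    refine hv.mono' (Measurable.aestronglyMeasurable (by fun_prop)) (.of_forall fun x => ?_)
    rcases (he0 x).eq_or_lt with h0 | h0
    · rw [← h0]; simp; positivity
    · rw [mul_div_cancel₀ _ h0.ne', Real.norm_of_nonneg (Real.exp_pos _).le]
  -- A sandwich: e^{ξ_f − ξ} bounds from above, and 1 + log(v/e) ≤ v/e, with v the density of the
  -- recovered plan, bounds from below. The integral of v/e against π is at most the mass 1 of v.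
  have hmid : Integrable (fun x : E D × E D => optAux ε f x.1 - ξ x.1) π := by
    refine integrable_of_le_of_le (Measurable.aestronglyMeasurable (by fun_prop)) ?_
      (.of_forall fun x => (le_add_of_nonneg_right zero_le_one).trans (Real.add_one_le_exp _))
      (((((integrable_const (1 : ℝ)).sub hve).sub hlog).add (hfi'.div_const ε)).sub hξi') hup'
    filter_upwards [ae_pos_of_density he hπ] with x hx
    have h1 := Real.add_one_le_exp (f x.2 / ε - optAux ε f x.1 - Real.log (e x))
    rw [Real.exp_sub, Real.exp_log hx] at h1
    simp only [Pi.sub_apply, Pi.add_apply]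
    linarith
  have hfin : Integrable (fun x : E D × E D => optAux ε f x.1) π :=
    (hmid.add hξi').congr (.of_forall fun x => by simp)
  exact (mpf.integrable_comp hm.aestronglyMeasurable).1 hfin

/-- The divergence from a plan of finite entropy to the recovered plan. -/
lemma klDiv_plan {π : Measure (E D × E D)} {e : E D × E D → ℝ} [Fact (0 < ε)]
    [IsProbabilityMeasure p₀] [IsProbabilityMeasure π] (hfst : π.fst = p₀) (hsnd : π.snd = p₁)
    (he : Measurable e)
    (hπ : π = (refPlan ε p₀).withDensity fun x => ENNReal.ofReal (e x))
    (hlog : Integrable (fun x => Real.log (e x)) π) (hf : f ∈ integrableFns p₁)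
    (hZ : ∀ᵐ x₀ ∂p₀, Integrable (gibbs ε f x₀)) (hoi : Integrable (optAux ε f) p₀) :
    klDiv π (plan ε p₀ f) ≠ ∞ ∧ (klDiv π (plan ε p₀ f)).toReal
      = ∫ x, Real.log (e x) ∂π - (∫ x, f x ∂p₁) / ε + ∫ x, optAux ε f x ∂p₀ := by
  have hε : 0 < ε := Fact.out
  obtain ⟨hfm, hfi⟩ := hf
  have hm := measurable_optAux (ε := ε) hfm
  have mpf : MeasurePreserving Prod.fst π p₀ := ⟨measurable_fst, hfst⟩
  have mps : MeasurePreserving Prod.snd π p₁ := ⟨measurable_snd, hsnd⟩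
  have hfi' : Integrable (fun x : E D × E D => f x.2 / ε) π :=
    (mps.integrable_comp_of_integrable hfi).div_const ε
  have hoi' : Integrable (fun x : E D × E D => optAux ε f x.1) π :=
    mpf.integrable_comp_of_integrable hoi
  have hprob := isProbabilityMeasure_plan (p₀ := p₀) hε hfm hZ
  set v : E D × E D → ℝ := fun x => Real.exp (f x.2 / ε - optAux ε f x.1) with hv
  have hvm : Measurable v := by fun_prop
  have hv0 : ∀ x, 0 < v x := fun x => Real.exp_pos _
  have hπ' : π = (plan ε p₀ f).withDensity fun x => ENNReal.ofReal (e x / v x) := by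
    rw [plan_eq_refPlan_withDensity hε hfm,
      ← withDensity_mul _ hvm.ennreal_ofReal (by fun_prop), hπ]
    congr 1
    ext x
    rw [Pi.mul_apply, ← ENNReal.ofReal_mul (hv0 x).le, mul_div_cancel₀ _ (hv0 x).ne']
  have hac : π ≪ plan ε p₀ f := by
    rw [hπ']; exact withDensity_absolutelyContinuous _ _
  have hllr : llr π (plan ε p₀ f) =ᵐ[π]
      fun x => Real.log (e x) - f x.2 / ε + optAux ε f x.1 := by
    have hrn : π.rnDeriv (plan ε p₀ f) =ᵐ[plan ε p₀ f] fun x => ENNReal.ofReal (e x / v x) := by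
      conv_lhs => rw [hπ']
      exact Measure.rnDeriv_withDensity _ (by fun_prop)
    filter_upwards [hac.ae_eq hrn, ae_pos_of_density he hπ] with x h1 h2
    rw [llr, h1, ENNReal.toReal_ofReal (div_pos h2 (hv0 x)).le,
      Real.log_div h2.ne' (hv0 x).ne', hv, Real.log_exp]
    ring
  have hI1 : Integrable (fun x => Real.log (e x) - f x.2 / ε) π := hlog.sub hfi'
  have hI : Integrable (llr π (plan ε p₀ f)) π := (hI1.add hoi').congr hllr.symm
  refine ⟨klDiv_ne_top hac hI, ?_⟩
  rw [toReal_klDiv_of_measure_eq hac (by simp), integral_congr_ae hllr, integral_add hI1 hoi',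
    integral_sub hlog hfi', integral_div, integral_comp_fst hm, integral_comp_snd hfm, hfst, hsnd]

/-- The divergence from the optimal plan to a recovered plan is controlled by the duality gap. -/
theorem IsEOTPlan.klDiv_plan_le {π : Measure (E D × E D)} [Fact (0 < ε)]
    [IsProbabilityMeasure p₀] [IsProbabilityMeasure π] (hπ : IsEOTPlan ε p₀ p₁ π)
    (hf : f ∈ integrableFns p₁) (hξ : ξ ∈ integrableFns p₀)
    (hZ : ∀ᵐ x₀ ∂p₀, Integrable (gibbs ε f x₀)) :
    dualLoss ε p₀ p₁ f ξ = ⊥ ∨ ∃ l : ℝ, dualLoss ε p₀ p₁ f ξ = l ∧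
      klDiv π (plan ε p₀ f) ≠ ∞ ∧
      ε * (klDiv π (plan ε p₀ f)).toReal ≤ eotCost ε p₀ π - l := by
  have hε : 0 < ε := Fact.out
  obtain ⟨⟨hfst, hsnd⟩, hfc, -⟩ := hπ
  obtain ⟨e, he, he0, hπe, hlog⟩ := hfc.exists_log_density (ε := ε) hfst
  have hval := (hasFiniteCost_of_log_density he hπe hfst hlog hfc.cost).2
  by_cases h : Integrable (fun x => Real.exp (f x.2 / ε - ξ x.1)) (refPlan ε p₀)
  · right
    have hoi := integrable_optAux hfst hsnd he he0 hπe hlog hf hξ hZ h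
    obtain ⟨h1, h2⟩ := integral_exp_sub_refPlan hε hf.1 hξ.1 hZ h
    obtain ⟨h3, h4⟩ := klDiv_plan hfst hsnd he hπe hlog hf hZ hoi
    refine ⟨_, dualLoss_of_integrable hε hf.1 hξ.1 h, h3, ?_⟩
    rw [h4, h2, hval, dualConst]
    -- The log-density integrals cancel; what is left is the slack of 1 + x ≤ e^x.
    have h5 := mul_le_mul_of_nonneg_left (integral_optAux_le hξ.2 hoi h1) hε.le
    have h6 : ε * ((∫ x, f x ∂p₁) / ε) = ∫ x, f x ∂p₁ := by field_simp
    linarith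
  · exact Or.inl (dualLoss_of_not_integrable hε hf.1 hξ.1 h)

end Plan

/-! ### From the duality gap to the expected divergence. -/

lemma exists_real_of_abs_sub_le {l : EReal} {a δ : ℝ}
    (h : (l - (a : EReal)).abs ≤ ENNReal.ofReal δ) (hδ : 0 ≤ δ) :
    ∃ r : ℝ, l = r ∧ |r - a| ≤ δ := by
  induction l with
  | bot => simp at h
  | top => simp at h
  | coe r =>
    rw [← EReal.coe_sub, EReal.abs_def, ENNReal.ofReal_le_ofReal_iff hδ] at h
    exact ⟨r, rfl, h⟩

lemma abs_sub_le_deviation {D N M K : ℕ} {ε : ℝ} {p₀ p₁ : Measure (E D)} {F Ξ : Set (E D → ℝ)}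
    {c : ℝ} {s : Sample D N M K} {f ξ : E D → ℝ} (hf : f ∈ F) (hξ : ξ ∈ Ξ) :
    (dualLoss ε p₀ p₁ f ξ - ((empLoss ε s f ξ + c : ℝ) : EReal)).abs
      ≤ deviation ε p₀ p₁ F Ξ c s :=
  (le_iSup₂ (f := fun ξ (_ : ξ ∈ Ξ) =>
    (dualLoss ε p₀ p₁ f ξ - ((empLoss ε s f ξ + c : ℝ) : EReal)).abs) ξ hξ).trans
    (le_iSup₂ (f := fun f (_ : f ∈ F) => ⨆ ξ ∈ Ξ,
      (dualLoss ε p₀ p₁ f ξ - ((empLoss ε s f ξ + c : ℝ) : EReal)).abs) f hf)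

section Bound

variable {D : ℕ} {ε : ℝ} [Fact (0 < ε)] {p₀ p₁ : Measure (E D)} [IsProbabilityMeasure p₀]
  {π : Measure (E D × E D)} [IsProbabilityMeasure π] {F Ξ : Set (E D → ℝ)}

/-- Weak duality, from the nonnegativity of the divergence. It keeps the approximation gap
nonnegative and rules out ∞ − ∞. -/
lemma IsEOTPlan.iSup_dualLoss_le (hπ : IsEOTPlan ε p₀ p₁ π) (hF : F ⊆ integrableFns p₁)
    (hFZ : ∀ f ∈ F, ∀ᵐ x₀ ∂p₀, Integrable (gibbs ε f x₀) volume) (hΞ : Ξ ⊆ integrableFns p₀) :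
    ⨆ f ∈ F, ⨆ ξ ∈ Ξ, dualLoss ε p₀ p₁ f ξ ≤ (eotCost ε p₀ π : EReal) := by
  have hε : 0 < ε := Fact.out
  refine iSup₂_le fun f hf => iSup₂_le fun ξ hξ => ?_
  rcases hπ.klDiv_plan_le (hF hf) (hΞ hξ) (hFZ f hf) with h | ⟨l, h, -, hl⟩
  · rw [h]; exact bot_le
  · rw [h, EReal.coe_le_coe_iff]
    have := mul_nonneg hε.le (ENNReal.toReal_nonneg (a := klDiv π (plan ε p₀ f)))
    linarith

/-- Bound on the divergence for a fixed sample. -/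
lemma IsEOTPlan.klDiv_plan_le_deviation [IsProbabilityMeasure p₁] {N M K : ℕ}
    (hπ : IsEOTPlan ε p₀ p₁ π) (hF : F ⊆ integrableFns p₁)
    (hFZ : ∀ f ∈ F, ∀ᵐ x₀ ∂p₀, Integrable (gibbs ε f x₀) volume) (hΞ : Ξ ⊆ integrableFns p₀)
    (s : Sample D N M K) (c : ℝ) {fhat ξhat : E D → ℝ} (hfhat : fhat ∈ F) (hξhat : ξhat ∈ Ξ)
    (hmax : ∀ f ∈ F, ∀ ξ ∈ Ξ, ∃ ξ' ∈ Ξ, dualLoss ε p₀ p₁ f ξ ≤ dualLoss ε p₀ p₁ f ξ' ∧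
      empLoss ε s f ξ' ≤ empLoss ε s fhat ξhat) :
    ENNReal.ofReal ε * klDiv π (plan ε p₀ fhat) ≤ 2 * deviation ε p₀ p₁ F Ξ c s
      + (dualValue ε p₀ p₁ - ⨆ f ∈ F, ⨆ ξ ∈ Ξ, dualLoss ε p₀ p₁ f ξ).toENNReal := by
  have hε : 0 < ε := Fact.out
  rcases eq_or_ne (deviation ε p₀ p₁ F Ξ c s) ∞ with hd | hd
  · simp [hd]
  obtain ⟨δ, hδ, hdδ⟩ : ∃ δ : ℝ, 0 ≤ δ ∧ deviation ε p₀ p₁ F Ξ c s = ENNReal.ofReal δ :=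
    ⟨_, ENNReal.toReal_nonneg, (ENNReal.ofReal_toReal hd).symm⟩
  have hreal : ∀ f ∈ F, ∀ ξ ∈ Ξ, ∃ r : ℝ, dualLoss ε p₀ p₁ f ξ = r ∧
      |r - (empLoss ε s f ξ + c)| ≤ δ := fun f hf ξ hξ =>
    exists_real_of_abs_sub_le ((abs_sub_le_deviation hf hξ).trans_eq hdδ) hδ
  obtain ⟨l, hl, hlδ⟩ := hreal fhat hfhat ξhat hξhat
  set σ : EReal := ⨆ f ∈ F, ⨆ ξ ∈ Ξ, dualLoss ε p₀ p₁ f ξ with hσ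
  have hσle : σ ≤ ((l + 2 * δ : ℝ) : EReal) := by
    refine iSup₂_le fun f hf => iSup₂_le fun ξ hξ => ?_
    -- The auxiliary function ξ' is ξ_f in case (a) and ξ itself in case (b). Two uses of the
    -- deviation around the empirical comparison cost 2δ, and the constant `c` cancels.
    obtain ⟨ξ', hξ', h1, h2⟩ := hmax f hf ξ hξ
    obtain ⟨r, hr, hrδ⟩ := hreal f hf ξ' hξ'
    refine h1.trans ?_
    rw [hr, EReal.coe_le_coe_iff]
    linarith [abs_le.1 hlδ, abs_le.1 hrδ]
  have hkl : klDiv π (plan ε p₀ fhat) ≠ ∞ ∧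
      ε * (klDiv π (plan ε p₀ fhat)).toReal ≤ eotCost ε p₀ π - l := by
    rcases hπ.klDiv_plan_le (hF hfhat) (hΞ hξhat) (hFZ fhat hfhat) with h | ⟨l', h, h1, h2⟩
    · rw [hl] at h; exact absurd h (EReal.coe_ne_bot _)
    · rw [hl, EReal.coe_eq_coe_iff] at h
      exact ⟨h1, h ▸ h2⟩
  have hgap : ((eotCost ε p₀ π - (l + 2 * δ) : ℝ) : EReal) ≤ dualValue ε p₀ p₁ - σ := by
    rw [EReal.coe_sub]
    exact EReal.sub_le_sub hπ.eotCost_le_dualValue hσle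
  have hgap' := EReal.toENNReal_le_toENNReal hgap
  rw [EReal.real_coe_toENNReal] at hgap'
  have htwo : 2 * ENNReal.ofReal δ = ENNReal.ofReal (2 * δ) := by
    rw [ENNReal.ofReal_mul zero_le_two]; simp
  rw [← ENNReal.ofReal_toReal hkl.1, ← ENNReal.ofReal_mul hε.le, hdδ, htwo]
  calc ENNReal.ofReal (ε * (klDiv π (plan ε p₀ fhat)).toReal)
      ≤ ENNReal.ofReal (2 * δ + (eotCost ε p₀ π - (l + 2 * δ))) :=
        ENNReal.ofReal_le_ofReal (by linarith [hkl.2])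
    _ ≤ ENNReal.ofReal (2 * δ) + ENNReal.ofReal (eotCost ε p₀ π - (l + 2 * δ)) :=
        ENNReal.ofReal_add_le
    _ ≤ _ := add_le_add_right hgap' _

/-- Integration of the bound for a fixed sample over the random sample. -/
lemma IsEOTPlan.expected_klDiv_le [IsProbabilityMeasure p₁]
    (hπ : IsEOTPlan ε p₀ p₁ π) (hF : F ⊆ integrableFns p₁)
    (hFZ : ∀ f ∈ F, ∀ᵐ x₀ ∂p₀, Integrable (gibbs ε f x₀) volume) (hΞ : Ξ ⊆ integrableFns p₀)
    {Ω : Type*} [MeasurableSpace Ω] (P : Measure Ω) [IsProbabilityMeasure P] {k d : Ω → ℝ≥0∞}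
    (h : ∀ᵐ ω ∂P, ENNReal.ofReal ε * k ω ≤ 2 * d ω
      + (dualValue ε p₀ p₁ - ⨆ f ∈ F, ⨆ ξ ∈ Ξ, dualLoss ε p₀ p₁ f ξ).toENNReal) :
    (ε : EReal) * ((∫⁻ ω, k ω ∂P : ℝ≥0∞) : EReal) ≤ 2 * ((∫⁻ ω, d ω ∂P : ℝ≥0∞) : EReal)
      + (dualValue ε p₀ p₁ - ⨆ f ∈ F, ⨆ ξ ∈ Ξ, dualLoss ε p₀ p₁ f ξ) := by
  have hε : 0 < ε := Fact.out
  have hle := hπ.iSup_dualLoss_le hF hFZ hΞ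
  set σ : EReal := ⨆ f ∈ F, ⨆ ξ ∈ Ξ, dualLoss ε p₀ p₁ f ξ with hσ
  have hdual := hπ.eotCost_le_dualValue
  have hgap : 0 ≤ dualValue ε p₀ p₁ - σ :=
    (EReal.sub_nonneg (.inr (hle.trans_lt (EReal.coe_lt_top _)).ne)
      (.inl ((EReal.bot_lt_coe _).trans_le hdual).ne')).2 (hle.trans hdual)
  -- `k` and `d` may be non-measurable, so only rules for `∫⁻` that ask nothing of them are applied.
  have h1 := lintegral_mono_ae h
  rw [lintegral_const_mul' _ _ ENNReal.ofReal_ne_top, lintegral_add_right _ measurable_const,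
    lintegral_const_mul' _ _ (by simp), lintegral_const, measure_univ, mul_one] at h1
  have h2 := EReal.coe_ennreal_le_coe_ennreal_iff.2 h1
  rw [EReal.coe_ennreal_add, EReal.coe_ennreal_mul, EReal.coe_ennreal_mul,
    EReal.coe_toENNReal hgap, EReal.coe_ennreal_ofReal, max_eq_left hε.le] at h2
  exact h2

end Bound

end VarEOT

end

theorem mainTheorem5 {D N M K : ℕ} (hN : 0 < N) (hM : 0 < M) (hK : 0 < K)
    {ε : ℝ} (hε : 0 < ε)
    (p₀ p₁ : Measure (VarEOT.E D)) [IsProbabilityMeasure p₀] [IsProbabilityMeasure p₁]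
    (hp₀ : p₀ ≪ volume) (hp₁ : p₁ ≪ volume)
    -- the ground truth entropic optimal transport plan
    (πstar : Measure (VarEOT.E D × VarEOT.E D)) [IsProbabilityMeasure πstar]
    (hπstar : VarEOT.IsEOTPlan ε p₀ p₁ πstar)
    -- the classes of potentials and of auxiliary functions
    (F Ξ : Set (VarEOT.E D → ℝ))
    (hF : F ⊆ VarEOT.integrableFns p₁)
    (hFZ : ∀ f ∈ F, ∀ᵐ x₀ ∂p₀, Integrable (VarEOT.gibbs ε f x₀) volume)
    (hΞ : Ξ ⊆ VarEOT.integrableFns p₀)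
    -- the random data
    {Ω : Type*} [MeasurableSpace Ω] (P : Measure Ω) [IsProbabilityMeasure P]
    (S : Ω → VarEOT.Sample D N M K) (hS : HasLaw S (VarEOT.sampleLaw p₀ p₁ N M K) P)
    -- the additive constant included in the empirical loss when it is compared with `L`
    (c : ℝ) :
    -- maximizer over `F` of the empirical loss with the optimal auxiliary function plugged in
    ((∀ f ∈ F, VarEOT.optAux ε f ∈ Ξ) →
      ∀ fhat : Ω → VarEOT.E D → ℝ,
        (∀ᵐ ω ∂P, fhat ω ∈ F ∧ ∀ f ∈ F,
          VarEOT.empLoss ε (S ω) f (VarEOT.optAux ε f)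
            ≤ VarEOT.empLoss ε (S ω) (fhat ω) (VarEOT.optAux ε (fhat ω))) →
        (ε : EReal) * ((∫⁻ ω, klDiv πstar (VarEOT.plan ε p₀ (fhat ω)) ∂P : ℝ≥0∞) : EReal)
          ≤ 2 * ((∫⁻ ω, VarEOT.deviation ε p₀ p₁ F Ξ c (S ω) ∂P : ℝ≥0∞) : EReal)
            + (VarEOT.dualValue ε p₀ p₁ - ⨆ f ∈ F, ⨆ ξ ∈ Ξ, VarEOT.dualLoss ε p₀ p₁ f ξ)) ∧
    -- joint maximizer of the empirical loss over `F × Ξ`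
    (∀ (fhat ξhat : Ω → VarEOT.E D → ℝ),
        (∀ᵐ ω ∂P, fhat ω ∈ F ∧ ξhat ω ∈ Ξ ∧ ∀ f ∈ F, ∀ ξ ∈ Ξ,
          VarEOT.empLoss ε (S ω) f ξ ≤ VarEOT.empLoss ε (S ω) (fhat ω) (ξhat ω)) →
        (ε : EReal) * ((∫⁻ ω, klDiv πstar (VarEOT.plan ε p₀ (fhat ω)) ∂P : ℝ≥0∞) : EReal)
          ≤ 2 * ((∫⁻ ω, VarEOT.deviation ε p₀ p₁ F Ξ c (S ω) ∂P : ℝ≥0∞) : EReal)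
            + (VarEOT.dualValue ε p₀ p₁ - ⨆ f ∈ F, ⨆ ξ ∈ Ξ, VarEOT.dualLoss ε p₀ p₁ f ξ)) := by
  have : Fact (0 < ε) := ⟨hε⟩
  refine ⟨fun hopt fhat hfhat => ?_, fun fhat ξhat hmax => ?_⟩
  · refine hπstar.expected_klDiv_le hF hFZ hΞ P ?_
    filter_upwards [hfhat] with ω hω
    refine hπstar.klDiv_plan_le_deviation hF hFZ hΞ (S ω) c hω.1 (hopt _ hω.1)
      fun f hf ξ hξ => ⟨_, hopt f hf, ?_, hω.2 f hf⟩
    -- Plugging in ξ_f loses nothing in the population loss, so maximizing over `F` alone competes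
    -- with the supremum over `F` and `Ξ`.
    exact VarEOT.dualLoss_le_dualLoss_optAux hε (hF hf).1 (hFZ f hf) (hΞ hξ) (hΞ (hopt f hf)).2
  · refine hπstar.expected_klDiv_le hF hFZ hΞ P ?_
    filter_upwards [hmax] with ω hω
    exact hπstar.klDiv_plan_le_deviation hF hFZ hΞ (S ω) c hω.1 hω.2.1
      fun f hf ξ hξ => ⟨ξ, hξ, le_rfl, hω.2.2 f hf ξ hξ⟩
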